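/- Let $h_b(t)=-t\log_2 t-(1-t)\log_2(1-t)$ be the binary entropy function and let $\oplus$ be addition modulo $2$. For $p\in[0,1]$ let $S_1,S_2$ be i.i.d. Bernoulli($p$) and $S_3=S_1\oplus S_2$. For $\delta\in[0,1]$ consider the three-user memoryless multiple-access channel with inputs $X_1,X_2,X_3\in\{0,1\}$ and output $Y=(Y_1,Y_2)\in\{0,1\}^2$ given by $$(Y_1,Y_2)=\begin{cases}(X_1\oplus N_\delta,\;X_2\oplus N'_\delta)&\text{if }X_3=X_1\oplus X_2,\\ (N_{1/2},N'_{1/2})&\text{if }X_3\ne X_1\oplus X_2,\end{cases}$$ where $N_\delta,N'_\delta\sim\mathrm{Bernoulli}(\delta)$ and $N_{1/2},N'_{1/2}\sim\mathrm{Bernoulli}(1/2)$ are independent. A source is *transmissible* over the channel if for every $\epsilon>0$ and all sufficiently large $n$ there are encoders $e_i:\mathcal S_i^n\to\mathcal X_i^n$ ($i=1,2,3$) and a decoder $d:\mathcal Y^n\to\mathcal S_1^n\times\mathcal S_2^n\times\mathcal S_3^n$ such that $n$ i.i.d. samples of the source, sent with $n$ uses of the channel, are decoded with error probability at most $\epsilon$.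 For a set of users, a *common part* of their sources is a random variable $W$ of largest entropy that is almost surely a function of each of these sources separately; let $W_{123}$ and $W_{12},W_{13},W_{23}$ be common parts of all three sources and of the pairs. A source satisfies the *three-user CES (unstructured) sufficient condition* if there are finite-alphabet auxiliary variables $\underline U=(U_{123},U_{12},U_{13},U_{23})$ and a conditional law of $(\underline U,\underline X)$ given $\underline S$ of the form $$P_{U_{123}}\prod_{b\in\{12,13,23\}}P_{U_b|W_bU_{123}}\ \prod_{i=1}^{3}P_{X_i|S_iU_{123}U_{ij}U_{ik}}\qquad(\{i,j,k\}=\{1,2,3\})$$ such that, with $Y$ the channel output for the input $\underline X$, for all distinct $i,j,k\in\{1,2,3\}$ and all $\mathcal B\subseteq\{12,13,23\}$ (identifying $U_{ij}=U_{ji}$, $W_{ij}=W_{ji}$) \begin{align*} H(S_i|S_jS_k)&\le I(X_i;Y|S_jS_kX_jX_kU_{123}U_{12}U_{13}U_{23}),\\ H(S_iS_j|S_k)&\le I(X_iX_j;Y|S_kU_{123}U_{ik}U_{jk}X_k),\\ H(S_iS_j|S_kW_{ij})&\le I(X_iX_j;Y|S_kW_{ij}U_{123}U_{12}U_{13}U_{23}X_k),\\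 H(S_1S_2S_3|W_{123}W_{\mathcal B})&\le I(X_1X_2X_3;Y|W_{123}W_{\mathcal B}U_{123}U_{\mathcal B}),\\ H(S_1S_2S_3)&\le I(X_1X_2X_3;Y). \end{align*} Then, for every $\delta\in[0,1]$: 1. For every $p\in[0,1]$, the source $(S_1,S_2,S_3)$ is transmissible over the channel if and only if $h_b(p)<1-h_b(\delta)$, or $h_b(p)=1-h_b(\delta)$ and $\delta\in\{0,\tfrac12,1\}$. 2. If $\delta\notin\{0,\tfrac12,1\}$, then every source with $h_b(p)=1-h_b(\delta)$ (in particular with $p=h_b^{-1}(1-h_b(\delta))$, the inverse being taken on $[0,\tfrac12]$) does not satisfy the three-user CES sufficient condition. Moreover there is $\eta>0$ such that every source with $1-h_b(\delta)-\eta<h_b(p)<1-h_b(\delta)$ is transmissible over the channel and does not satisfy the CES condition. -/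

import Mathlib

/-! Three users are indexed by `Fin 3`. All alphabets are finite; entropies are in bits. -/

namespace MACSources

noncomputable section

/-! ### Sources, channels, transmissibility -/

/-- A discrete memoryless source with three components: the law of one sample. -/
structure Source (𝒮 : Fin 3 → Type) [∀ i, Fintype (𝒮 i)] where
  prob : (∀ i, 𝒮 i) → ℝ
  mem_simplex : prob ∈ stdSimplex ℝ (∀ i, 𝒮 i)

/-- A discrete memoryless MAC with three users: the transition probabilities of one use. -/
structure MAC (𝒳 : Fin 3 → Type) (𝒴 : Type) [Fintype 𝒴] where
  prob : (∀ i, 𝒳 i) → 𝒴 → ℝ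
  mem_simplex : ∀ x, prob x ∈ stdSimplex ℝ 𝒴

section Transmission

variable {𝒮 𝒳 : Fin 3 → Type} {𝒴 : Type} [∀ i, Fintype (𝒮 i)] [Fintype 𝒴]

open Classical in
/-- Error probability of the blocklength-`n` coding scheme with encoders `e i` and decoder `d`. -/
def errorProb (P : Source 𝒮) (Q : MAC 𝒳 𝒴) (n : ℕ)
    (e : ∀ i, (Fin n → 𝒮 i) → (Fin n → 𝒳 i)) (d : (Fin n → 𝒴) → ∀ i, Fin n → 𝒮 i) : ℝ :=
  ∑ s : (∀ i, Fin n → 𝒮 i), (∏ t, P.prob (fun i => s i t)) *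
    ∑ y : Fin n → 𝒴 with d y ≠ s, ∏ t, Q.prob (fun i => e i (s i) t) (y t)

/-- Reliable transmission with one channel use per source sample. -/
def Transmissible (P : Source 𝒮) (Q : MAC 𝒳 𝒴) : Prop :=
  ∀ ε : ℝ, 0 < ε → ∃ N : ℕ, ∀ n : ℕ, N ≤ n →
    ∃ (e : ∀ i, (Fin n → 𝒮 i) → (Fin n → 𝒳 i)) (d : (Fin n → 𝒴) → ∀ i, Fin n → 𝒮 i),
      errorProb P Q n e d ≤ ε

end Transmission

/-! ### Entropy and mutual information on a finite sample space -/

section Entropy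

variable {Ω α β γ : Type} [Fintype Ω] [Fintype α] [Fintype β] [Fintype γ]

open Classical in
/-- Probability mass function of the random variable `X` under the weights `μ`. -/
def law (μ : Ω → ℝ) (X : Ω → α) (a : α) : ℝ := ∑ ω with X ω = a, μ ω

/-- `H(X)` in bits. -/
def entropy (μ : Ω → ℝ) (X : Ω → α) : ℝ := (∑ a, Real.negMulLog (law μ X a)) / Real.log 2

/-- `H(X | Z) = H(X, Z) - H(Z)`. -/
def condEntropy (μ : Ω → ℝ) (X : Ω → α) (Z : Ω → γ) : ℝ :=
  entropy μ (fun ω => (X ω, Z ω)) - entropy μ Z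

/-- `I(X ; Y) = H(X) - H(X | Y)`. -/
def mutualInfo (μ : Ω → ℝ) (X : Ω → α) (Y : Ω → β) : ℝ := entropy μ X - condEntropy μ X Y

/-- `I(X ; Y | Z) = H(X | Z) - H(X | Y, Z)`. -/
def condMutualInfo (μ : Ω → ℝ) (X : Ω → α) (Y : Ω → β) (Z : Ω → γ) : ℝ :=
  condEntropy μ X Z - condEntropy μ X (fun ω => (Y ω, Z ω))

/-- The binary entropy function in bits. -/
def hb (p : ℝ) : ℝ := Real.binEntropy p / Real.log 2

end Entropy

/-! ### Common parts and the three-user CES condition -/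

section CES

variable {𝒮 𝒳 : Fin 3 → Type} {𝒴 : Type}
  [∀ i, Fintype (𝒮 i)] [∀ i, Fintype (𝒳 i)] [Fintype 𝒴]

/-- `W` is almost surely a function of `S_i` alone, for each user `i ∈ A`. -/
def IsCommonFunction (P : Source 𝒮) (A : Set (Fin 3)) {k : ℕ} (W : (∀ i, 𝒮 i) → Fin k) : Prop :=
  ∀ i ∈ A, ∃ f : 𝒮 i → Fin k, ∀ s, P.prob s ≠ 0 → W s = f (s i)

/-- `W` is a (Gács–Körner–Witsenhausen) common part of the sources of the users in `A`: a common
function of largest entropy. -/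
def IsCommonPart (P : Source 𝒮) (A : Set (Fin 3)) {k : ℕ} (W : (∀ i, 𝒮 i) → Fin k) : Prop :=
  IsCommonFunction P A W ∧
    ∀ (l : ℕ) (V : (∀ i, 𝒮 i) → Fin l), IsCommonFunction P A V →
      entropy P.prob V ≤ entropy P.prob W

/-- A choice of the common parts of the source together with an element of `𝒫_CES`, i.e. a
conditional law of `(U, X)` given `S` that factors as
`P(u₁₂₃) ∏_b P(u_b | w_b, u₁₂₃) ∏_i P(x_i | s_i, u₁₂₃, u_ij, u_ik)`.
A pair `b = {i, j}` of users is indexed by the remaining user: `W k`, `U k` stand for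
`W_ij`, `U_ij` with `{i, j, k} = {1, 2, 3}`; so user `i` uses `U k` for all `k ≠ i`. -/
structure CESScheme (P : Source 𝒮) (𝒳 : Fin 3 → Type) [∀ i, Fintype (𝒳 i)] where
  sizeW₁₂₃ : ℕ
  sizeW : Fin 3 → ℕ
  W₁₂₃ : (∀ i, 𝒮 i) → Fin sizeW₁₂₃
  W : ∀ k, (∀ i, 𝒮 i) → Fin (sizeW k)
  isCommonPart₁₂₃ : IsCommonPart P Set.univ W₁₂₃
  isCommonPart : ∀ k, IsCommonPart P {i | i ≠ k} (W k)
  sizeU₁₂₃ : ℕ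
  sizeU : Fin 3 → ℕ
  pU₁₂₃ : Fin sizeU₁₂₃ → ℝ
  pU₁₂₃_mem : pU₁₂₃ ∈ stdSimplex ℝ (Fin sizeU₁₂₃)
  pU : ∀ k, Fin (sizeW k) → Fin sizeU₁₂₃ → Fin (sizeU k) → ℝ
  pU_mem : ∀ k w u₀, pU k w u₀ ∈ stdSimplex ℝ (Fin (sizeU k))
  pX : ∀ i, 𝒮 i → Fin sizeU₁₂₃ → (∀ k : {k : Fin 3 // k ≠ i}, Fin (sizeU k)) → 𝒳 i → ℝ
  pX_mem : ∀ i s u₀ u, pX i s u₀ u ∈ stdSimplex ℝ (𝒳 i)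

namespace CESScheme

variable {P : Source 𝒮}

/-- Joint realizations `(s, u₁₂₃, (u_b)_b, x, y)`. -/
abbrev Sample (c : CESScheme P 𝒳) (𝒴 : Type) : Type :=
  (∀ i, 𝒮 i) × Fin c.sizeU₁₂₃ × (∀ k, Fin (c.sizeU k)) × (∀ i, 𝒳 i) × 𝒴

/-- The joint law `P_S · P_{U,X|S} · P_{Y|X}`. -/
def joint (c : CESScheme P 𝒳) (Q : MAC 𝒳 𝒴) : c.Sample 𝒴 → ℝ
  | (s, u₀, u, x, y) =>
    P.prob s * c.pU₁₂₃ u₀ * (∏ k, c.pU k (c.W k s) u₀ (u k)) *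
      (∏ i, c.pX i (s i) u₀ (fun k => u k) (x i)) * Q.prob x y

end CESScheme

/-- The inequalities of the three-user CES sufficient condition for a given scheme. In the second
one `U_ik`, `U_jk` are `u j`, `u i`; in the third one `W_ij` is `c.W k`. -/
structure CESScheme.Inequalities {P : Source 𝒮} (c : CESScheme P 𝒳) (Q : MAC 𝒳 𝒴) : Prop where
  one : ∀ i j k : Fin 3, i ≠ j → i ≠ k → j ≠ k →
    condEntropy P.prob (fun s => s i) (fun s => (s j, s k)) ≤
      condMutualInfo (c.joint Q) (fun (_, _, _, x, _) => x i) (fun (_, _, _, _, y) => y)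
        (fun (s, u₀, u, x, _) => (s j, s k, x j, x k, u₀, u))
  two : ∀ i j k : Fin 3, i ≠ j → i ≠ k → j ≠ k →
    condEntropy P.prob (fun s => (s i, s j)) (fun s => s k) ≤
      condMutualInfo (c.joint Q) (fun (_, _, _, x, _) => (x i, x j)) (fun (_, _, _, _, y) => y)
        (fun (s, u₀, u, x, _) => (s k, u₀, u j, u i, x k))
  two_common : ∀ i j k : Fin 3, i ≠ j → i ≠ k → j ≠ k →
    condEntropy P.prob (fun s => (s i, s j)) (fun s => (s k, c.W k s)) ≤
      condMutualInfo (c.joint Q) (fun (_, _, _, x, _) => (x i, x j)) (fun (_, _, _, _, y) => y)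
        (fun (s, u₀, u, x, _) => (s k, c.W k s, u₀, u, x k))
  three_common : ∀ B : Finset (Fin 3),
    condEntropy P.prob (fun s => s) (fun s => (c.W₁₂₃ s, fun b : B => c.W b s)) ≤
      condMutualInfo (c.joint Q) (fun (_, _, _, x, _) => x) (fun (_, _, _, _, y) => y)
        (fun (s, u₀, u, _, _) => (c.W₁₂₃ s, fun b : B => c.W b s, u₀, fun b : B => u b))
  three : entropy P.prob (fun s => s) ≤
    mutualInfo (c.joint Q) (fun (_, _, _, x, _) => x) (fun (_, _, _, _, y) => y)

/-- The three-user CES (unstructured coding) sufficient condition for transmitting `P` over `Q`. -/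
def CESCondition (P : Source 𝒮) (Q : MAC 𝒳 𝒴) : Prop :=
  ∃ c : CESScheme P 𝒳, c.Inequalities Q

end CES

/-! ### The binary additive source and channel -/

/-- The Bernoulli mass function on `ZMod 2`. -/
def bern (p : ℝ) (x : ZMod 2) : ℝ := if x = 1 then p else 1 - p

theorem bern_nonneg {p : ℝ} (hp : p ∈ Set.Icc (0 : ℝ) 1) (x : ZMod 2) : 0 ≤ bern p x := by
  unfold bern
  split_ifs
  · exact hp.1
  · linarith [hp.2]

theorem sum_bern (p : ℝ) : ∑ x, bern p x = 1 := by
  have : (Finset.univ : Finset (ZMod 2)) = {0, 1} := rfl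
  rw [this, Finset.sum_pair (by decide)]
  simp [bern]

theorem sum_bern_sub (p : ℝ) (a : ZMod 2) : ∑ x, bern p (x - a) = 1 := by
  rw [← sum_bern p]
  exact Fintype.sum_equiv (Equiv.subRight a) _ _ (fun _ => rfl)

/-- `S₁, S₂` i.i.d. Bernoulli(`p`) and `S₃ = S₁ ⊕ S₂`. -/
def xorSource (p : ℝ) (hp : p ∈ Set.Icc (0 : ℝ) 1) : Source (fun _ => ZMod 2) where
  prob s := if s 2 = s 0 + s 1 then bern p (s 0) * bern p (s 1) else 0
  mem_simplex := by
    refine ⟨fun s => ?_, ?_⟩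
    · beta_reduce
      split_ifs
      · exact mul_nonneg (bern_nonneg hp _) (bern_nonneg hp _)
      · exact le_rfl
    · rw [← (Fin.consEquiv (fun _ : Fin 3 => ZMod 2)).sum_comp, Fintype.sum_prod_type]
      rw [← sum_bern p]
      refine Finset.sum_congr rfl fun a _ => ?_
      rw [← (Fin.consEquiv (fun _ : Fin 2 => ZMod 2)).sum_comp, Fintype.sum_prod_type]
      rw [← mul_one (bern p a), ← sum_bern p, Finset.mul_sum]
      refine Finset.sum_congr rfl fun b _ => ?_
      rw [← (Equiv.funUnique (Fin 1) (ZMod 2)).symm.sum_comp]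
      simp [Fin.consEquiv, Fin.cons, Fin.cases, Fin.induction, Fin.induction.go]

/-- Output `(X₁ ⊕ N, X₂ ⊕ N')` with independent Bernoulli(`δ`) noises if `X₃ = X₁ ⊕ X₂`, and two
independent fair bits otherwise. -/
def xorMAC (δ : ℝ) (hδ : δ ∈ Set.Icc (0 : ℝ) 1) : MAC (fun _ => ZMod 2) (ZMod 2 × ZMod 2) where
  prob x y :=
    if x 2 = x 0 + x 1 then bern δ (y.1 - x 0) * bern δ (y.2 - x 1)
    else bern (1 / 2) y.1 * bern (1 / 2) y.2
  mem_simplex x := by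
    have hh : (1 / 2 : ℝ) ∈ Set.Icc (0 : ℝ) 1 := by constructor <;> norm_num
    refine ⟨fun y => ?_, ?_⟩
    · split_ifs
      · exact mul_nonneg (bern_nonneg hδ _) (bern_nonneg hδ _)
      · exact mul_nonneg (bern_nonneg hh _) (bern_nonneg hh _)
    · split_ifs
      · rw [Fintype.sum_prod_type, ← Finset.sum_mul_sum (f := fun a => bern δ (a - x 0))
          (g := fun b => bern δ (b - x 1)), sum_bern_sub, sum_bern_sub, one_mul]
      · rw [Fintype.sum_prod_type, ← Finset.sum_mul_sum (f := bern (1 / 2))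
          (g := bern (1 / 2)), sum_bern, one_mul]

end

end MACSources

namespace MACSources

open Finset

/-! ### Moments of sums of independent variables on finite product spaces -/

section Moments

variable {α : Type*} [Fintype α]

/-! Achievability rests on structure. If all three users apply the same linear map over the field
with two elements, then S₃ = S₁ ⊕ S₂ gives X₃ = X₁ ⊕ X₂ in every channel use. The channel then acts
as two independent binary symmetric channels, each carrying a Bernoulli(p) source. A random square
matrix with typical-set decoding succeeds when h(p) + h(δ) < log 2 (`exists_additiveError_le`,
`errorProb_addDecoder_le`).

For the converse, the source has entropy 2h(p) and every input leaves output entropy at least 2h(δ),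
while the output has only four values. A decoder is correct on at most 4ⁿ pairs of source and output
blocks, one per output block, so the pairs of small probability are mostly decoded wrongly
(`le_errorProb`). Above the critical rate Chebyshev's inequality makes almost all pairs small. At
the critical rate with δ ∉ {0, 1/2, 1}, p is neither deterministic nor uniform. The information
density then fluctuates on the scale √n, and a fourth-moment bound shows that it exceeds its mean by
that order with probability bounded below, so the error cannot vanish (`not_transmissible_of_le`).
For δ ∈ {0, 1} there is no noise to correct, and for δ = 1/2 equality forces a deterministic source.

The CES condition fails because, for 0 < p < 1, two components of the source take every pair of
values with positive probability. All common parts are therefore constant, and the auxiliary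
variables are independent of the source. Given them, each user applies an independent randomized map
to its own bit, and some realization must yield information at least 2h(p)
(`exists_infoGain_ge_of_CESCondition`). At the critical rate this would require inputs that always
satisfy the parity constraint and a uniform output. The former makes the first user's map
deterministic and the latter makes X₁ uniform, which is impossible for a function of a biased bit
(`infoGain_lt`). Compactness extends the strict inequality to a neighbourhood of the critical rate
(`exists_infoGain_lt`). -/

theorem sum_fin_succ_pi {n : ℕ} (F : (Fin (n + 1) → α) → ℝ) :
    ∑ y, F y = ∑ a : α, ∑ y : Fin n → α, F (Fin.cons a y) := by
  rw [← (Fin.consEquiv (fun _ : Fin (n + 1) => α)).sum_comp, Fintype.sum_prod_type]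
  rfl

theorem sum_pi_prod_eq_one {n : ℕ} (q : Fin n → α → ℝ) (hq : ∀ t, ∑ a, q t a = 1) :
    ∑ y : Fin n → α, ∏ t, q t (y t) = 1 := by
  classical
  rw [← Fintype.piFinset_univ, ← Finset.prod_univ_sum]
  simp [hq]

theorem sum_pi_prod_mul_sum_eq_zero {n : ℕ} (q f : Fin n → α → ℝ) (hq : ∀ t, ∑ a, q t a = 1)
    (hf : ∀ t, ∑ a, q t a * f t a = 0) :
    ∑ y : Fin n → α, (∏ t, q t (y t)) * ∑ t, f t (y t) = 0 := by
  induction n with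
  | zero => simp
  | succ n ih =>
    have h1 := sum_pi_prod_eq_one (fun t => q (Fin.succ t)) (fun t => hq _)
    have h2 := ih (fun t => q (Fin.succ t)) (fun t => f (Fin.succ t)) (fun t => hq _)
      (fun t => hf _)
    rw [sum_fin_succ_pi]
    simp only [Fin.prod_univ_succ, Fin.sum_univ_succ, Fin.cons_zero, Fin.cons_succ]
    calc _ = (∑ a, q 0 a * f 0 a) * (∑ y : Fin n → α, ∏ t, q (Fin.succ t) (y t))
          + (∑ a, q 0 a) * ∑ y : Fin n → α, (∏ t, q (Fin.succ t) (y t)) *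
            ∑ t, f (Fin.succ t) (y t) := by
          simp only [Finset.sum_mul_sum, ← Finset.sum_add_distrib]
          exact Finset.sum_congr rfl fun a _ => Finset.sum_congr rfl fun y _ => by ring
      _ = 0 := by rw [hf, h2]; simp

theorem sum_pi_prod_mul_sum_sq {n : ℕ} (q f : Fin n → α → ℝ) (hq : ∀ t, ∑ a, q t a = 1)
    (hf : ∀ t, ∑ a, q t a * f t a = 0) :
    ∑ y : Fin n → α, (∏ t, q t (y t)) * (∑ t, f t (y t)) ^ 2
      = ∑ t, ∑ a, q t a * f t a ^ 2 := by
  induction n with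
  | zero => simp
  | succ n ih =>
    have h1 := sum_pi_prod_eq_one (fun t => q (Fin.succ t)) (fun t => hq _)
    have h2 := ih (fun t => q (Fin.succ t)) (fun t => f (Fin.succ t)) (fun t => hq _)
      (fun t => hf _)
    rw [sum_fin_succ_pi]
    simp only [Fin.prod_univ_succ, Fin.sum_univ_succ, Fin.cons_zero, Fin.cons_succ]
    calc _ = (∑ a, q 0 a * f 0 a ^ 2) * (∑ y : Fin n → α, ∏ t, q (Fin.succ t) (y t))
          + 2 * ((∑ a, q 0 a * f 0 a) * ∑ y : Fin n → α, (∏ t, q (Fin.succ t) (y t)) *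
            ∑ t, f (Fin.succ t) (y t))
          + (∑ a, q 0 a) * ∑ y : Fin n → α, (∏ t, q (Fin.succ t) (y t)) *
            (∑ t, f (Fin.succ t) (y t)) ^ 2 := by
          simp only [Finset.sum_mul_sum, Finset.mul_sum _ _ (2 : ℝ),
            ← Finset.sum_add_distrib]
          exact Finset.sum_congr rfl fun a _ => Finset.sum_congr rfl fun y _ => by ring
      _ = _ := by rw [hf, h1, h2, hq]; ring

theorem sum_mul_sq_le {q f : α → ℝ} {M : ℝ} (hq0 : ∀ a, 0 ≤ q a) (hq : ∑ a, q a = 1)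
    (hM : ∀ a, |f a| ≤ M) : ∑ a, q a * f a ^ 2 ≤ M ^ 2 := by
  calc ∑ a, q a * f a ^ 2 ≤ ∑ a, q a * M ^ 2 := by
        refine Finset.sum_le_sum fun a _ => mul_le_mul_of_nonneg_left ?_ (hq0 a)
        exact sq_le_sq' (neg_le_of_abs_le (hM a)) (le_of_abs_le (hM a))
    _ = M ^ 2 := by rw [← Finset.sum_mul, hq, one_mul]

theorem sum_pi_prod_mul_sum_sq_le {n : ℕ} (q f : Fin n → α → ℝ) {M : ℝ}
    (hq0 : ∀ t a, 0 ≤ q t a) (hq : ∀ t, ∑ a, q t a = 1)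
    (hf : ∀ t, ∑ a, q t a * f t a = 0) (hM : ∀ t a, |f t a| ≤ M) :
    ∑ y : Fin n → α, (∏ t, q t (y t)) * (∑ t, f t (y t)) ^ 2 ≤ n * M ^ 2 := by
  rw [sum_pi_prod_mul_sum_sq q f hq hf]
  calc _ ≤ ∑ _t : Fin n, M ^ 2 := Finset.sum_le_sum fun t _ =>
        sum_mul_sq_le (hq0 t) (hq t) (hM t)
    _ = _ := by simp

/-- Expand the fourth power around one coordinate. The two cross terms containing a first moment
vanish by centring, and the rest obeys the recursion behind 3(n + 1)² = 3n² + 6n + 3. The growth n²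
matches the square of the variance, as the lower tail bound at the critical rate requires. -/
theorem sum_pi_prod_mul_sum_pow_four_le {n : ℕ} (q f : Fin n → α → ℝ) {M : ℝ}
    (hq0 : ∀ t a, 0 ≤ q t a) (hq : ∀ t, ∑ a, q t a = 1)
    (hf : ∀ t, ∑ a, q t a * f t a = 0) (hM : ∀ t a, |f t a| ≤ M) :
    ∑ y : Fin n → α, (∏ t, q t (y t)) * (∑ t, f t (y t)) ^ 4 ≤ 3 * n ^ 2 * M ^ 4 := by
  induction n with
  | zero => simp
  | succ n ih =>
    have h1 := sum_pi_prod_eq_one (fun t => q (Fin.succ t)) (fun t => hq _)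
    have hz := sum_pi_prod_mul_sum_eq_zero (fun t => q (Fin.succ t)) (fun t => f (Fin.succ t))
      (fun t => hq _) (fun t => hf _)
    have h2 := sum_pi_prod_mul_sum_sq_le (fun t => q (Fin.succ t)) (fun t => f (Fin.succ t))
      (fun t => hq0 _) (fun t => hq _) (fun t => hf _) (fun t => hM _)
    have h4 := ih (fun t => q (Fin.succ t)) (fun t => f (Fin.succ t)) (fun t => hq0 _)
      (fun t => hq _) (fun t => hf _) (fun t => hM _)
    have g2 := sum_mul_sq_le (hq0 0) (hq 0) (hM 0)
    have g4 : ∑ a, q 0 a * f 0 a ^ 4 ≤ M ^ 4 := by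
      have := sum_mul_sq_le (f := fun a => f 0 a ^ 2) (M := M ^ 2) (hq0 0) (hq 0) (fun a => by
        rw [abs_of_nonneg (sq_nonneg _)]
        exact sq_le_sq' (neg_le_of_abs_le (hM 0 a)) (le_of_abs_le (hM 0 a)))
      simpa only [← pow_mul] using this
    have p2 : 0 ≤ ∑ y : Fin n → α, (∏ t, q (Fin.succ t) (y t)) *
        (∑ t, f (Fin.succ t) (y t)) ^ 2 :=
      Finset.sum_nonneg fun y _ => mul_nonneg (Finset.prod_nonneg fun t _ => hq0 _ _) (sq_nonneg _)
    rw [sum_fin_succ_pi]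
    simp only [Fin.prod_univ_succ, Fin.sum_univ_succ, Fin.cons_zero, Fin.cons_succ]
    calc _ = (∑ a, q 0 a * f 0 a ^ 4) * (∑ y : Fin n → α, ∏ t, q (Fin.succ t) (y t))
          + 4 * ((∑ a, q 0 a * f 0 a ^ 3) * ∑ y : Fin n → α, (∏ t, q (Fin.succ t) (y t)) *
            ∑ t, f (Fin.succ t) (y t))
          + 6 * ((∑ a, q 0 a * f 0 a ^ 2) * ∑ y : Fin n → α, (∏ t, q (Fin.succ t) (y t)) *
            (∑ t, f (Fin.succ t) (y t)) ^ 2)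
          + 4 * ((∑ a, q 0 a * f 0 a) * ∑ y : Fin n → α, (∏ t, q (Fin.succ t) (y t)) *
            (∑ t, f (Fin.succ t) (y t)) ^ 3)
          + (∑ a, q 0 a) * ∑ y : Fin n → α, (∏ t, q (Fin.succ t) (y t)) *
            (∑ t, f (Fin.succ t) (y t)) ^ 4 := by
          simp only [Finset.sum_mul_sum, Finset.mul_sum _ _ (4 : ℝ), Finset.mul_sum _ _ (6 : ℝ),
            ← Finset.sum_add_distrib]
          exact Finset.sum_congr rfl fun a _ => Finset.sum_congr rfl fun y _ => by ring
      _ ≤ M ^ 4 + 6 * (M ^ 2 * (n * M ^ 2)) + 3 * n ^ 2 * M ^ 4 := by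
          rw [hf, h1, hz, hq]
          have := mul_le_mul g2 h2 p2 (sq_nonneg M)
          linarith
      _ ≤ _ := by
          push_cast
          have : M ^ 4 = M ^ 2 * M ^ 2 := by ring
          nlinarith [mul_nonneg (sq_nonneg M) (sq_nonneg M)]

end Moments

/-! ### Tail probabilities from second and fourth moments -/

section Tails

variable {Ω : Type*} [Fintype Ω]

/-- Chebyshev's inequality for finite weights. -/
theorem sum_filter_le_div_sq (μ Z : Ω → ℝ) (h0 : ∀ ω, 0 ≤ μ ω) {c V : ℝ} (hc : 0 < c)
    (hV : ∑ ω, μ ω * Z ω ^ 2 ≤ V) : ∑ ω with c ≤ |Z ω|, μ ω ≤ V / c ^ 2 := by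
  rw [le_div_iff₀ (by positivity), Finset.sum_mul]
  refine le_trans ?_ hV
  refine (Finset.sum_le_sum fun ω hω => ?_).trans
    (Finset.sum_le_sum_of_subset_of_nonneg (Finset.filter_subset (fun ω => c ≤ |Z ω|) univ)
      fun ω _ _ => mul_nonneg (h0 ω) (sq_nonneg _))
  rw [Finset.mem_filter] at hω
  refine mul_le_mul_of_nonneg_left ?_ (h0 ω)
  rw [← sq_abs (Z ω)]
  exact pow_le_pow_left₀ hc.le hω.2 2

/-- A centred variable whose second moment is at least one and whose fourth moment is bounded
exceeds a positive level with probability bounded below. -/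
theorem exists_le_sum_filter_of_moments {K : ℝ} (hK : 1 ≤ K) :
    ∃ θ : ℝ, 0 < θ ∧ ∃ c : ℝ, 0 < c ∧ ∀ {Ω : Type} [Fintype Ω] (μ Z : Ω → ℝ), (∀ ω, 0 ≤ μ ω) →
      ∑ ω, μ ω = 1 → ∑ ω, μ ω * Z ω = 0 → 1 ≤ ∑ ω, μ ω * Z ω ^ 2 →
      ∑ ω, μ ω * Z ω ^ 4 ≤ K → c ≤ ∑ ω with θ ≤ Z ω, μ ω := by
  have hK0 : 0 < K := by linarith
  set C : ℝ := K + (K + 1) ^ 2 * K with hC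
  have hCpos : 0 < C := by positivity
  refine ⟨1 / (16 * K), by positivity, 1 / (4 * C), by positivity, ?_⟩
  intro Ω _ μ Z h0 h1 hm h2 h4
  -- A polynomial minorant of a multiple of the indicator. Its mean is at least 0 + 1 - 1/2 - 1/4 =
  -- 1/4, whence the level 1 / (4C). The linear term has mean zero; it cancels z² for -2K ≤ z < 0,
  -- and the quartic term does so further left.
  have key : ∀ z : ℝ, 2 * K * z + z ^ 2 - 1 / (2 * K) * z ^ 4 - 1 / 4 ≤
      C * if 1 / (16 * K) ≤ z then 1 else 0 := by
    intro z
    split_ifs with hz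
    · have e1 : 0 ≤ (z - 1) ^ 2 := sq_nonneg _
      have e2 : (K + 1) * z ^ 2 - 1 / (2 * K) * z ^ 4 ≤ (K + 1) ^ 2 * K := by
        have : 0 ≤ 1 / (2 * K) * (z ^ 2 - (K + 1) * K) ^ 2 := by positivity
        have e : 1 / (2 * K) * (z ^ 2 - (K + 1) * K) ^ 2
            = 1 / (2 * K) * z ^ 4 - (K + 1) * z ^ 2 + (K + 1) ^ 2 * K / 2 := by
          field_simp
          ring
        have : 0 ≤ (K + 1) ^ 2 * K := by positivity
        linarith
      have e3 : 2 * K * z ≤ K * (1 + z ^ 2) := by nlinarith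
      rw [hC]
      nlinarith
    · rw [mul_zero]
      push Not at hz
      have h4' : 0 ≤ 1 / (2 * K) * z ^ 4 := by positivity
      rcases le_or_gt 0 z with h | h
      · have e1 : 2 * K * z ≤ 1 / 8 := by
          calc 2 * K * z ≤ 2 * K * (1 / (16 * K)) := by gcongr
            _ = 1 / 8 := by field_simp; norm_num
        have e2 : z ≤ 1 / 16 := hz.le.trans (by
          apply one_div_le_one_div_of_le <;> linarith)
        nlinarith
      · have : z ^ 2 + 2 * K * z ≤ 1 / (2 * K) * z ^ 4 := by
          rcases le_or_gt (-(2 * K)) z with h' | h'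
          · nlinarith
          · have e1 : 2 * K ≤ z ^ 2 := by nlinarith
            have e2 : z ^ 2 ≤ 1 / (2 * K) * z ^ 4 := by
              rw [div_mul_eq_mul_div, le_div_iff₀ (by positivity)]
              nlinarith [sq_nonneg z]
            nlinarith
        linarith
  have hsum := Finset.sum_le_sum fun ω (_ : ω ∈ univ) =>
    mul_le_mul_of_nonneg_left (key (Z ω)) (h0 ω)
  have hl : ∑ ω, μ ω * (2 * K * Z ω + Z ω ^ 2 - 1 / (2 * K) * Z ω ^ 4 - 1 / 4)
      = 2 * K * (∑ ω, μ ω * Z ω) + ∑ ω, μ ω * Z ω ^ 2 - 1 / (2 * K) * (∑ ω, μ ω * Z ω ^ 4)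
        - 1 / 4 * ∑ ω, μ ω := by
    simp only [Finset.mul_sum, ← Finset.sum_add_distrib, ← Finset.sum_sub_distrib]
    exact Finset.sum_congr rfl fun ω _ => by ring
  have hr : ∑ ω, μ ω * (C * if 1 / (16 * K) ≤ Z ω then 1 else 0)
      = C * ∑ ω with 1 / (16 * K) ≤ Z ω, μ ω := by
    rw [Finset.sum_filter, Finset.mul_sum]
    exact Finset.sum_congr rfl fun ω _ => by split_ifs <;> ring
  rw [hl, hr, hm, h1] at hsum
  have h5 : 1 / (2 * K) * (∑ ω, μ ω * Z ω ^ 4) ≤ 1 / 2 := by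
    calc _ ≤ 1 / (2 * K) * K := by gcongr
      _ = 1 / 2 := by field_simp
  rw [div_le_iff₀ (by positivity)]
  linarith

end Tails

/-! ### Information densities and the converse -/

section InfoDev

variable {α : Type*} [Fintype α]

/-- The centred information density `-log q(a) - H(q)`, in nats. -/
noncomputable def infoDev (q : α → ℝ) (a : α) : ℝ :=
  -Real.log (q a) - ∑ b, Real.negMulLog (q b)

theorem sum_mul_infoDev {q : α → ℝ} (hq : ∑ a, q a = 1) : ∑ a, q a * infoDev q a = 0 := by
  have h : ∀ a, q a * infoDev q a =
      Real.negMulLog (q a) - q a * ∑ b, Real.negMulLog (q b) := fun a => by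
    simp only [infoDev, Real.negMulLog]; ring
  simp only [h, Finset.sum_sub_distrib, ← Finset.sum_mul, hq, one_mul, sub_self]

/-- If a product of weights is nonzero, it is the exponential of its information density. -/
theorem prod_eq_exp_infoDev {n : ℕ} (q : Fin n → α → ℝ) (h0 : ∀ t a, 0 ≤ q t a) (y : Fin n → α)
    (hy : ∏ t, q t (y t) ≠ 0) :
    ∏ t, q t (y t) = Real.exp (-(∑ t, infoDev (q t) (y t)
      + ∑ t, ∑ b, Real.negMulLog (q t b))) := by
  have hpos : ∀ t, 0 < q t (y t) := fun t =>
    lt_of_le_of_ne (h0 t _) (Ne.symm (Finset.prod_ne_zero_iff.1 hy t (mem_univ t)))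
  rw [← Finset.sum_add_distrib, ← Finset.sum_neg_distrib, Real.exp_sum]
  refine Finset.prod_congr rfl fun t _ => ?_
  simp only [infoDev, sub_add_cancel, neg_neg, Real.exp_log (hpos t)]

end InfoDev

/-! ### One-shot converse from the information density -/

section Converse

variable {𝒮 𝒳 : Fin 3 → Type} {𝒴 : Type} [Fintype 𝒴]

theorem sum_channel_block (Q : MAC 𝒳 𝒴) {n : ℕ}
    (e : ∀ i, (Fin n → 𝒮 i) → (Fin n → 𝒳 i)) (s : ∀ i, Fin n → 𝒮 i) :
    ∑ y : Fin n → 𝒴, (∏ t, Q.prob (fun i => e i (s i) t) (y t)) = 1 :=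
  sum_pi_prod_eq_one (fun t => Q.prob (fun i => e i (s i) t)) fun _ => (Q.mem_simplex _).2

theorem sum_channel_dev (Q : MAC 𝒳 𝒴) {n : ℕ}
    (e : ∀ i, (Fin n → 𝒮 i) → (Fin n → 𝒳 i)) (s : ∀ i, Fin n → 𝒮 i) :
    ∑ y : Fin n → 𝒴, (∏ t, Q.prob (fun i => e i (s i) t) (y t)) *
      ∑ t, infoDev (Q.prob (fun i => e i (s i) t)) (y t) = 0 :=
  sum_pi_prod_mul_sum_eq_zero _ (fun t => infoDev (Q.prob (fun i => e i (s i) t)))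
    (fun _ => (Q.mem_simplex _).2) fun _ => sum_mul_infoDev (Q.mem_simplex _).2

variable [∀ i, Fintype (𝒮 i)]

theorem sum_pi_swap {n : ℕ} (F : (Fin n → ∀ i, 𝒮 i) → ℝ) :
    ∑ s : (∀ i, Fin n → 𝒮 i), F (fun t i => s i t) = ∑ s, F s :=
  (Equiv.piComm (fun (i : Fin 3) (_ : Fin n) => 𝒮 i)).sum_comp F

/-- Joint law of the source block and the channel output block. -/
def blockLaw (P : Source 𝒮) (Q : MAC 𝒳 𝒴) (n : ℕ)
    (e : ∀ i, (Fin n → 𝒮 i) → (Fin n → 𝒳 i)) (ω : (∀ i, Fin n → 𝒮 i) × (Fin n → 𝒴)) : ℝ :=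
  (∏ t, P.prob (fun i => ω.1 i t)) * ∏ t, Q.prob (fun i => e i (ω.1 i) t) (ω.2 t)

/-- Centred information density of the source block and the channel output block. -/
noncomputable def blockDev (P : Source 𝒮) (Q : MAC 𝒳 𝒴) (n : ℕ)
    (e : ∀ i, (Fin n → 𝒮 i) → (Fin n → 𝒳 i)) (ω : (∀ i, Fin n → 𝒮 i) × (Fin n → 𝒴)) : ℝ :=
  (∑ t, infoDev P.prob (fun i => ω.1 i t)) +
    ∑ t, infoDev (Q.prob (fun i => e i (ω.1 i) t)) (ω.2 t)

variable (P : Source 𝒮) (Q : MAC 𝒳 𝒴) {n : ℕ} (e : ∀ i, (Fin n → 𝒮 i) → (Fin n → 𝒳 i))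

theorem blockLaw_nonneg (ω) : 0 ≤ blockLaw P Q n e ω :=
  mul_nonneg (prod_nonneg fun _ _ => P.mem_simplex.1 _)
    (prod_nonneg fun _ _ => (Q.mem_simplex _).1 _)

theorem sum_blockLaw_mul (F : (∀ i, Fin n → 𝒮 i) → (Fin n → 𝒴) → ℝ) :
    ∑ ω, blockLaw P Q n e ω * F ω.1 ω.2 =
      ∑ s : (∀ i, Fin n → 𝒮 i), (∏ t, P.prob (fun i => s i t)) *
        ∑ y : Fin n → 𝒴, (∏ t, Q.prob (fun i => e i (s i) t) (y t)) * F s y := by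
  rw [Fintype.sum_prod_type]
  refine Finset.sum_congr rfl fun s _ => ?_
  rw [Finset.mul_sum]
  exact Finset.sum_congr rfl fun y _ => by simp only [blockLaw]; ring

theorem sum_source_block : ∑ s : (∀ i, Fin n → 𝒮 i), (∏ t, P.prob (fun i => s i t)) = 1 :=
  (sum_pi_swap (fun s : Fin n → ∀ i, 𝒮 i => ∏ t, P.prob (s t))).trans
    (sum_pi_prod_eq_one (fun _ => P.prob) fun _ => P.mem_simplex.2)

theorem sum_blockLaw : ∑ ω, blockLaw P Q n e ω = 1 := by
  have := sum_blockLaw_mul P Q e (fun _ _ => 1)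
  simpa only [mul_one, sum_channel_block, sum_source_block] using this

theorem sum_blockLaw_mul_blockDev : ∑ ω, blockLaw P Q n e ω * blockDev P Q n e ω = 0 := by
  refine (sum_blockLaw_mul P Q e (fun s y => blockDev P Q n e (s, y))).trans ?_
  simp only [blockDev, mul_add, Finset.sum_add_distrib, sum_channel_dev, add_zero,
    ← Finset.sum_mul, sum_channel_block, one_mul]
  exact (sum_pi_swap (fun s : Fin n → ∀ i, 𝒮 i =>
    (∏ t, P.prob (s t)) * ∑ t, infoDev P.prob (s t))).trans
    (sum_pi_prod_mul_sum_eq_zero _ (fun _ => infoDev P.prob) (fun _ => P.mem_simplex.2)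
      fun _ => sum_mul_infoDev P.mem_simplex.2)

/-- The cross term vanishes because the channel part is centred given the source block. The source
part alone then bounds the variance from below, whatever the encoders. -/
theorem sum_blockLaw_mul_blockDev_sq :
    ∑ ω, blockLaw P Q n e ω * blockDev P Q n e ω ^ 2 =
      n * (∑ s, P.prob s * infoDev P.prob s ^ 2) +
      ∑ s : (∀ i, Fin n → 𝒮 i), (∏ t, P.prob (fun i => s i t)) *
        ∑ y : Fin n → 𝒴, (∏ t, Q.prob (fun i => e i (s i) t) (y t)) *
          (∑ t, infoDev (Q.prob (fun i => e i (s i) t)) (y t)) ^ 2 := by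
  refine (sum_blockLaw_mul P Q e (fun s y => blockDev P Q n e (s, y) ^ 2)).trans ?_
  have hA : ∑ s : (∀ i, Fin n → 𝒮 i), (∏ t, P.prob (fun i => s i t)) *
      (∑ t, infoDev P.prob (fun i => s i t)) ^ 2 = n * ∑ s, P.prob s * infoDev P.prob s ^ 2 := by
    refine (sum_pi_swap (fun s : Fin n → ∀ i, 𝒮 i =>
      (∏ t, P.prob (s t)) * (∑ t, infoDev P.prob (s t)) ^ 2)).trans ?_
    rw [sum_pi_prod_mul_sum_sq _ (fun _ => infoDev P.prob) (fun _ => P.mem_simplex.2)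
      fun _ => sum_mul_infoDev P.mem_simplex.2]
    simp
  rw [← hA, ← Finset.sum_add_distrib]
  refine Finset.sum_congr rfl fun s _ => ?_
  rw [← mul_add]
  congr 1
  set a := ∑ t, infoDev P.prob (fun i => s i t) with ha
  calc _ = a ^ 2 * (∑ y : Fin n → 𝒴, (∏ t, Q.prob (fun i => e i (s i) t) (y t)))
      + 2 * a * (∑ y : Fin n → 𝒴, (∏ t, Q.prob (fun i => e i (s i) t) (y t)) *
      ∑ t, infoDev (Q.prob (fun i => e i (s i) t)) (y t)) +
      ∑ y : Fin n → 𝒴, (∏ t, Q.prob (fun i => e i (s i) t) (y t)) *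
        (∑ t, infoDev (Q.prob (fun i => e i (s i) t)) (y t)) ^ 2 := by
        rw [Finset.mul_sum, Finset.mul_sum, ← Finset.sum_add_distrib, ← Finset.sum_add_distrib]
        refine Finset.sum_congr rfl fun y _ => ?_
        simp only [blockDev, ← ha]
        ring
    _ = _ := by rw [sum_channel_block, sum_channel_dev]; ring

variable {P Q} in
theorem sum_blockLaw_mul_blockDev_sq_le {M : ℝ} (hP : ∀ s, |infoDev P.prob s| ≤ M)
    (hQ : ∀ x y, |infoDev (Q.prob x) y| ≤ M) :
    ∑ ω, blockLaw P Q n e ω * blockDev P Q n e ω ^ 2 ≤ 2 * n * M ^ 2 := by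
  rw [sum_blockLaw_mul_blockDev_sq]
  have h1 := sum_mul_sq_le P.mem_simplex.1 P.mem_simplex.2 hP
  have h2 : ∑ s : (∀ i, Fin n → 𝒮 i), (∏ t, P.prob (fun i => s i t)) *
        ∑ y : Fin n → 𝒴, (∏ t, Q.prob (fun i => e i (s i) t) (y t)) *
          (∑ t, infoDev (Q.prob (fun i => e i (s i) t)) (y t)) ^ 2 ≤
      ∑ s : (∀ i, Fin n → 𝒮 i), (∏ t, P.prob (fun i => s i t)) * (n * M ^ 2) :=
    Finset.sum_le_sum fun s _ => mul_le_mul_of_nonneg_left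
      (sum_pi_prod_mul_sum_sq_le _ (fun t => infoDev (Q.prob (fun i => e i (s i) t)))
        (fun _ => (Q.mem_simplex _).1) (fun _ => (Q.mem_simplex _).2)
        (fun _ => sum_mul_infoDev (Q.mem_simplex _).2) (fun _ => hQ _))
      (prod_nonneg fun _ _ => P.mem_simplex.1 _)
  rw [← Finset.sum_mul, sum_source_block] at h2
  have := mul_le_mul_of_nonneg_left h1 (Nat.cast_nonneg (α := ℝ) n)
  linarith

variable {P Q} in
theorem sum_blockLaw_mul_blockDev_pow_four_le {M : ℝ} (hP : ∀ s, |infoDev P.prob s| ≤ M)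
    (hQ : ∀ x y, |infoDev (Q.prob x) y| ≤ M) :
    ∑ ω, blockLaw P Q n e ω * blockDev P Q n e ω ^ 4 ≤ 48 * n ^ 2 * M ^ 4 := by
  have hA : ∑ s : (∀ i, Fin n → 𝒮 i), (∏ t, P.prob (fun i => s i t)) *
      (∑ t, infoDev P.prob (fun i => s i t)) ^ 4 ≤ 3 * n ^ 2 * M ^ 4 :=
    (sum_pi_swap (fun s : Fin n → ∀ i, 𝒮 i =>
      (∏ t, P.prob (s t)) * (∑ t, infoDev P.prob (s t)) ^ 4)).trans_le
      (sum_pi_prod_mul_sum_pow_four_le _ (fun _ => infoDev P.prob) (fun _ => P.mem_simplex.1)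
        (fun _ => P.mem_simplex.2) (fun _ => sum_mul_infoDev P.mem_simplex.2) fun _ => hP)
  have hB : ∀ s : (∀ i, Fin n → 𝒮 i),
      ∑ y : Fin n → 𝒴, (∏ t, Q.prob (fun i => e i (s i) t) (y t)) *
        (∑ t, infoDev (Q.prob (fun i => e i (s i) t)) (y t)) ^ 4 ≤ 3 * n ^ 2 * M ^ 4 := fun s =>
    sum_pi_prod_mul_sum_pow_four_le _ (fun t => infoDev (Q.prob (fun i => e i (s i) t)))
        (fun _ => (Q.mem_simplex _).1) (fun _ => (Q.mem_simplex _).2)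
        (fun _ => sum_mul_infoDev (Q.mem_simplex _).2) (fun _ => hQ _)
  refine (sum_blockLaw_mul P Q e (fun s y => blockDev P Q n e (s, y) ^ 4)).trans_le ?_
  have hs : ∀ s : (∀ i, Fin n → 𝒮 i), (∏ t, P.prob (fun i => s i t)) *
      ∑ y : Fin n → 𝒴, (∏ t, Q.prob (fun i => e i (s i) t) (y t)) * blockDev P Q n e (s, y) ^ 4
      ≤ (∏ t, P.prob (fun i => s i t)) * (8 * (∑ t, infoDev P.prob (fun i => s i t)) ^ 4
        + 8 * (3 * n ^ 2 * M ^ 4)) := fun s => by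
    refine mul_le_mul_of_nonneg_left ?_ (prod_nonneg fun _ _ => P.mem_simplex.1 _)
    set a := ∑ t, infoDev P.prob (fun i => s i t) with ha
    calc _ ≤ ∑ y : Fin n → 𝒴, (∏ t, Q.prob (fun i => e i (s i) t) (y t)) *
          (8 * a ^ 4 + 8 * (∑ t, infoDev (Q.prob (fun i => e i (s i) t)) (y t)) ^ 4) := by
          refine Finset.sum_le_sum fun y _ => mul_le_mul_of_nonneg_left ?_
            (prod_nonneg fun _ _ => (Q.mem_simplex _).1 _)
          simp only [blockDev, ← ha]
          set b := ∑ t, infoDev (Q.prob (fun i => e i (s i) t)) (y t)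
          -- Two uses of (x + y)² ≤ 2(x² + y²) give (a + b)⁴ ≤ 8a⁴ + 8b⁴, and 48 = 8 · 3 + 8 · 3.
          have h1 : (a + b) ^ 2 ≤ 2 * (a ^ 2 + b ^ 2) := by nlinarith [sq_nonneg (a - b)]
          have h2 : (a ^ 2 + b ^ 2) ^ 2 ≤ 2 * (a ^ 4 + b ^ 4) := by
            nlinarith [sq_nonneg (a ^ 2 - b ^ 2)]
          have h3 := pow_le_pow_left₀ (sq_nonneg (a + b)) h1 2
          nlinarith
      _ = 8 * a ^ 4 * (∑ y : Fin n → 𝒴, (∏ t, Q.prob (fun i => e i (s i) t) (y t))) +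
          8 * ∑ y : Fin n → 𝒴, (∏ t, Q.prob (fun i => e i (s i) t) (y t)) *
            (∑ t, infoDev (Q.prob (fun i => e i (s i) t)) (y t)) ^ 4 := by
          rw [Finset.mul_sum, Finset.mul_sum, ← Finset.sum_add_distrib]
          exact Finset.sum_congr rfl fun y _ => by ring
      _ ≤ _ := by
          rw [sum_channel_block]
          linarith [hB s]
  refine (Finset.sum_le_sum fun s _ => hs s).trans ?_
  simp only [mul_add, Finset.sum_add_distrib, ← Finset.sum_mul, sum_source_block]
  simp only [mul_left_comm _ (8 : ℝ), ← Finset.mul_sum]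
  linarith

variable {P Q} in
open Classical in
/-- Information-spectrum converse for joint source-channel coding. -/
theorem le_errorProb (d : (Fin n → 𝒴) → ∀ i, Fin n → 𝒮 i) {h₀ : ℝ}
    (hQ : ∀ x, h₀ ≤ ∑ y, Real.negMulLog (Q.prob x y)) (γ : ℝ) :
    (∑ ω with γ ≤ blockDev P Q n e ω, blockLaw P Q n e ω) -
      (Fintype.card 𝒴 : ℝ) ^ n *
        Real.exp (-(γ + n * ((∑ s, Real.negMulLog (P.prob s)) + h₀))) ≤ errorProb P Q n e d := by
  set τ := Real.exp (-(γ + n * ((∑ s, Real.negMulLog (P.prob s)) + h₀))) with hτ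
  -- The law is the exponential of minus its information density, whose mean given the inputs is at
  -- least n times source entropy plus h₀.
  have hsmall : ∀ ω, γ ≤ blockDev P Q n e ω → blockLaw P Q n e ω ≤ τ := by
    intro ω hω
    by_cases h : blockLaw P Q n e ω = 0
    · rw [h]; exact (Real.exp_pos _).le
    · have h1 := left_ne_zero_of_mul h
      have h2 := right_ne_zero_of_mul h
      rw [blockLaw, prod_eq_exp_infoDev (fun _ => P.prob) (fun _ => P.mem_simplex.1)
        (fun t i => ω.1 i t) h1, prod_eq_exp_infoDev (fun t => Q.prob (fun i => e i (ω.1 i) t))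
        (fun _ => (Q.mem_simplex _).1) ω.2 h2, ← Real.exp_add]
      refine Real.exp_le_exp.2 ?_
      have h3 : (n : ℝ) * h₀ ≤ ∑ t : Fin n, ∑ y,
          Real.negMulLog (Q.prob (fun i => e i (ω.1 i) t) y) := by
        calc _ = ∑ _t : Fin n, h₀ := by simp
          _ ≤ _ := Finset.sum_le_sum fun t _ => hQ _
      simp only [blockDev] at hω
      simp only [Finset.sum_const, Finset.card_univ, Fintype.card_fin, nsmul_eq_mul]
      linarith
  have herr : errorProb P Q n e d = ∑ ω with d ω.2 ≠ ω.1, blockLaw P Q n e ω := by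
    rw [errorProb, Finset.sum_filter, Fintype.sum_prod_type]
    refine Finset.sum_congr rfl fun s _ => ?_
    rw [Finset.sum_filter, Finset.mul_sum]
    exact Finset.sum_congr rfl fun y _ => by simp only [blockLaw, mul_ite, mul_zero]
  -- Each output block is decoded to a single source block, so the correct pairs form the graph of
  -- `d` and number |𝒴|ⁿ.
  have hcorr : ∑ ω with d ω.2 = ω.1, (if γ ≤ blockDev P Q n e ω then blockLaw P Q n e ω else 0)
      ≤ (Fintype.card 𝒴 : ℝ) ^ n * τ := by
    calc _ ≤ ∑ ω : (∀ i, Fin n → 𝒮 i) × (Fin n → 𝒴) with d ω.2 = ω.1, τ := by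
          refine Finset.sum_le_sum fun ω _ => ?_
          split_ifs with h
          · exact hsmall ω h
          · exact (Real.exp_pos _).le
      _ = _ := by
          rw [Finset.sum_const, nsmul_eq_mul]
          congr 1
          have : (univ.filter fun ω : (∀ i, Fin n → 𝒮 i) × (Fin n → 𝒴) => d ω.2 = ω.1)
              = univ.image fun y => (d y, y) := by
            ext ⟨s, y⟩
            simp [eq_comm]
          rw [this, Finset.card_image_of_injective _ fun a b h => (Prod.ext_iff.1 h).2]
          simp
  rw [herr, sub_le_iff_le_add, Finset.sum_filter,
    ← Finset.sum_filter_add_sum_filter_not univ (fun ω => d ω.2 ≠ ω.1)]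
  refine add_le_add (Finset.sum_le_sum fun ω _ => ?_) ?_
  · split_ifs
    · exact le_rfl
    · exact blockLaw_nonneg P Q e ω
  · simpa only [ne_eq, not_not] using hcorr

end Converse

/-! ### Asymptotic converse above and at the critical rate -/

section ConverseAsymptotic

variable {𝒮 𝒳 : Fin 3 → Type} {𝒴 : Type} [∀ i, Fintype (𝒮 i)] [∀ i, Fintype (𝒳 i)] [Fintype 𝒴]

theorem exists_infoDev_bound (P : Source 𝒮) (Q : MAC 𝒳 𝒴) : ∃ M : ℝ,
    1 ≤ M ∧ (∀ s, |infoDev P.prob s| ≤ M) ∧ ∀ x y, |infoDev (Q.prob x) y| ≤ M := by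
  refine ⟨1 + (∑ s, |infoDev P.prob s|) + ∑ x, ∑ y, |infoDev (Q.prob x) y|, ?_, ?_, ?_⟩
  · have : 0 ≤ ∑ s, |infoDev P.prob s| := by positivity
    have : 0 ≤ ∑ x, ∑ y, |infoDev (Q.prob x) y| := by positivity
    linarith
  · intro s
    have := single_le_sum (fun s _ => abs_nonneg (infoDev P.prob s)) (mem_univ s)
    have : 0 ≤ ∑ x, ∑ y, |infoDev (Q.prob x) y| := by positivity
    linarith
  · intro x y
    have h1 := single_le_sum (fun y _ => abs_nonneg (infoDev (Q.prob x) y)) (mem_univ y)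
    have h2 := single_le_sum (f := fun x => ∑ y, |infoDev (Q.prob x) y|)
      (fun x _ => Finset.sum_nonneg fun y _ => abs_nonneg (infoDev (Q.prob x) y)) (mem_univ x)
    have : 0 ≤ ∑ s, |infoDev P.prob s| := by positivity
    linarith

/-- No reliable transmission if source entropy plus least output entropy exceeds `log |𝒴|`. -/
theorem not_transmissible_of_lt (P : Source 𝒮) (Q : MAC 𝒳 𝒴) {h₀ : ℝ} [Nonempty 𝒴]
    (hQ : ∀ x, h₀ ≤ ∑ y, Real.negMulLog (Q.prob x y))
    (h : Real.log (Fintype.card 𝒴) < (∑ s, Real.negMulLog (P.prob s)) + h₀) :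
    ¬ Transmissible P Q := by
  intro hT
  obtain ⟨M, hM1, hMP, hMQ⟩ := exists_infoDev_bound P Q
  set Δ := (∑ s, Real.negMulLog (P.prob s)) + h₀ - Real.log (Fintype.card 𝒴) with hΔ
  have hΔ0 : 0 < Δ := by linarith
  obtain ⟨N, hN⟩ := hT (1 / 4) (by norm_num)
  have hl1 : Filter.Tendsto (fun n : ℕ => Real.exp (-(n * (Δ / 2)))) Filter.atTop (nhds 0) := by
    refine Real.tendsto_exp_neg_atTop_nhds_zero.comp ?_
    exact tendsto_natCast_atTop_atTop.atTop_mul_const (by positivity)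
  have hl2 : Filter.Tendsto (fun n : ℕ => 8 * M ^ 2 / Δ ^ 2 / (n : ℝ)) Filter.atTop (nhds 0) :=
    tendsto_const_div_atTop_nhds_zero_nat _
  obtain ⟨n, hnN, hn1, hn2, hn3⟩ := ((Filter.eventually_ge_atTop N).and
    ((hl1.eventually_lt_const (show (0 : ℝ) < 1 / 4 by norm_num)).and
    ((hl2.eventually_lt_const (show (0 : ℝ) < 1 / 4 by norm_num)).and
      (Filter.eventually_gt_atTop 0)))).exists
  have hnpos : (0 : ℝ) < n := by exact_mod_cast hn3
  obtain ⟨e, d, hed⟩ := hN n hnN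
  -- A threshold of half the entropy gap below the mean still leaves exp (-nΔ/2) for the counting
  -- term. Chebyshev and counting each lose less than 1/4, so the error exceeds 1/2.
  have h1 := le_errorProb (P := P) (Q := Q) e d hQ (-(n * (Δ / 2)))
  have hcard : (0 : ℝ) < Fintype.card 𝒴 := by exact_mod_cast Fintype.card_pos
  have h2 : (Fintype.card 𝒴 : ℝ) ^ n *
        Real.exp (-(-(n * (Δ / 2)) + n * ((∑ s, Real.negMulLog (P.prob s)) + h₀)))
      = Real.exp (-(n * (Δ / 2))) := by
    rw [← Real.exp_log hcard, ← Real.exp_nat_mul, ← Real.exp_add]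
    congr 1
    rw [hΔ]; ring
  have h3 := sum_filter_le_div_sq (blockLaw P Q n e) (blockDev P Q n e)
    (blockLaw_nonneg P Q e) (c := n * (Δ / 2)) (by positivity)
    (sum_blockLaw_mul_blockDev_sq_le e hMP hMQ)
  have h4 : 2 * n * M ^ 2 / (n * (Δ / 2)) ^ 2 = 8 * M ^ 2 / Δ ^ 2 / (n : ℝ) := by
    field_simp; ring
  have h5 : 1 - ∑ ω with n * (Δ / 2) ≤ |blockDev P Q n e ω|, blockLaw P Q n e ω ≤
      ∑ ω with -(n * (Δ / 2)) ≤ blockDev P Q n e ω, blockLaw P Q n e ω := by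
    rw [← sum_blockLaw P Q e, ← Finset.sum_filter_not_add_sum_filter univ
      (fun ω => n * (Δ / 2) ≤ |blockDev P Q n e ω|), add_sub_cancel_right]
    refine Finset.sum_le_sum_of_subset_of_nonneg ?_ fun ω _ _ => blockLaw_nonneg P Q e ω
    intro ω hω
    simp only [Finset.mem_filter, Finset.mem_univ, true_and, not_le] at hω ⊢
    exact (abs_lt.1 hω).1.le
  rw [h2] at h1
  rw [h4] at h3
  linarith

/-- At the critical rate there is no reliable transmission if the source has dispersion. -/
theorem not_transmissible_of_le (P : Source 𝒮) (Q : MAC 𝒳 𝒴) {h₀ : ℝ} [Nonempty 𝒴]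
    (hQ : ∀ x, h₀ ≤ ∑ y, Real.negMulLog (Q.prob x y))
    (h : Real.log (Fintype.card 𝒴) ≤ (∑ s, Real.negMulLog (P.prob s)) + h₀)
    (hV : 0 < ∑ s, P.prob s * infoDev P.prob s ^ 2) :
    ¬ Transmissible P Q := by
  intro hT
  obtain ⟨M, hM1, hMP, hMQ⟩ := exists_infoDev_bound P Q
  set V := ∑ s, P.prob s * infoDev P.prob s ^ 2 with hVdef
  -- After division by √(nV) the variance is at least one and the fourth moment at most 48M⁴/V²,
  -- uniformly in n and in the encoders; the extra 1 ensures K ≥ 1.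
  obtain ⟨θ, hθ, c, hc, hPZ⟩ := exists_le_sum_filter_of_moments
    (K := 1 + 48 * M ^ 4 / V ^ 2) (by have : 0 ≤ 48 * M ^ 4 / V ^ 2 := by positivity
                                      linarith)
  obtain ⟨N, hN⟩ := hT (c / 2) (by positivity)
  have hl1 : Filter.Tendsto (fun n : ℕ => Real.exp (-(Real.sqrt (n * V) * θ)))
      Filter.atTop (nhds 0) := by
    refine Real.tendsto_exp_neg_atTop_nhds_zero.comp ?_
    refine Filter.Tendsto.atTop_mul_const hθ (Real.tendsto_sqrt_atTop.comp ?_)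
    exact tendsto_natCast_atTop_atTop.atTop_mul_const hV
  obtain ⟨n, hnN, hn1, hn3⟩ := ((Filter.eventually_ge_atTop N).and
    ((hl1.eventually_lt_const (show (0 : ℝ) < c / 2 by positivity)).and
      (Filter.eventually_gt_atTop 0))).exists
  have hnpos : (0 : ℝ) < n := by exact_mod_cast hn3
  obtain ⟨e, d, hed⟩ := hN n hnN
  set r := Real.sqrt (n * V) with hr
  have hrpos : 0 < r := Real.sqrt_pos.2 (by positivity)
  have hr2 : r ^ 2 = n * V := Real.sq_sqrt (by positivity)
  -- The threshold lies θ√(nV) above the mean: the counting term still tends to zero, while the mass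
  -- beyond the threshold stays at least c.
  have h1 := le_errorProb (P := P) (Q := Q) e d hQ (r * θ)
  have hcard : (0 : ℝ) < Fintype.card 𝒴 := by exact_mod_cast Fintype.card_pos
  have h2 : (Fintype.card 𝒴 : ℝ) ^ n *
        Real.exp (-(r * θ + n * ((∑ s, Real.negMulLog (P.prob s)) + h₀)))
      ≤ Real.exp (-(r * θ)) := by
    rw [← Real.exp_log hcard, ← Real.exp_nat_mul, ← Real.exp_add]
    refine Real.exp_le_exp.2 ?_
    have := mul_le_mul_of_nonneg_left h hnpos.le
    linarith
  have h3 := hPZ (blockLaw P Q n e) (fun ω => blockDev P Q n e ω / r) (blockLaw_nonneg P Q e)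
    (sum_blockLaw P Q e)
    (by simp only [← mul_div_assoc, ← Finset.sum_div, sum_blockLaw_mul_blockDev, zero_div])
    (by
      simp only [div_pow, ← mul_div_assoc, ← Finset.sum_div]
      rw [hr2, le_div_iff₀ (by positivity), sum_blockLaw_mul_blockDev_sq, one_mul]
      refine le_add_of_nonneg_right (Finset.sum_nonneg fun s _ => mul_nonneg
        (prod_nonneg fun _ _ => P.mem_simplex.1 _) (Finset.sum_nonneg fun y _ => mul_nonneg
        (prod_nonneg fun _ _ => (Q.mem_simplex _).1 _) (sq_nonneg _))))
    (by
      simp only [div_pow, ← mul_div_assoc, ← Finset.sum_div]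
      have : r ^ 4 = (n * V) ^ 2 := by rw [← hr2]; ring
      rw [this, div_le_iff₀ (by positivity)]
      refine (sum_blockLaw_mul_blockDev_pow_four_le e hMP hMQ).trans ?_
      have : (1 + 48 * M ^ 4 / V ^ 2) * (n * V) ^ 2 = (n * V) ^ 2 + 48 * n ^ 2 * M ^ 4 := by
        field_simp
      rw [this]
      exact le_add_of_nonneg_left (sq_nonneg _))
  simp only [le_div_iff₀ hrpos, mul_comm θ r] at h3
  linarith

end ConverseAsymptotic

/-! ### Entropies of the additive source and channel -/

section XorEntropies

theorem sum_pi_three {α : Type*} [Fintype α] (F : (Fin 3 → α) → ℝ) :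
    ∑ s, F s = ∑ a, ∑ b, ∑ c, F ![a, b, c] := by
  rw [sum_fin_succ_pi]
  refine Finset.sum_congr rfl fun a _ => ?_
  rw [sum_fin_succ_pi]
  refine Finset.sum_congr rfl fun b _ => ?_
  rw [← (Equiv.funUnique (Fin 1) α).symm.sum_comp]
  refine Finset.sum_congr rfl fun c _ => congrArg F ?_
  ext i
  fin_cases i <;> rfl

theorem sum_zmod_two (f : ZMod 2 → ℝ) : ∑ x, f x = f 0 + f 1 := by
  have : (Finset.univ : Finset (ZMod 2)) = {0, 1} := rfl
  rw [this, Finset.sum_pair (by decide)]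

theorem sum_negMulLog_bern (p : ℝ) : ∑ x, Real.negMulLog (bern p x) = Real.binEntropy p := by
  rw [sum_zmod_two, Real.binEntropy_eq_negMulLog_add_negMulLog_one_sub]
  simp [bern, add_comm]

theorem sum_sum_negMulLog_mul {α β : Type*} [Fintype α] [Fintype β] {q : α → ℝ} {r : β → ℝ}
    (hq : ∑ a, q a = 1) (hr : ∑ b, r b = 1) :
    ∑ a, ∑ b, Real.negMulLog (q a * r b) =
      ∑ a, Real.negMulLog (q a) + ∑ b, Real.negMulLog (r b) := by
  simp only [Real.negMulLog_mul, Finset.sum_add_distrib, ← Finset.sum_mul, ← Finset.mul_sum, hq,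
    hr, one_mul]

theorem sum_negMulLog_bern_sub_mul (p : ℝ) (a b : ZMod 2) :
    ∑ y : ZMod 2 × ZMod 2, Real.negMulLog (bern p (y.1 - a) * bern p (y.2 - b)) =
      2 * Real.binEntropy p := by
  have h : ∀ a, ∑ x, Real.negMulLog (bern p (x - a)) = Real.binEntropy p := fun a =>
    ((Equiv.subRight a).sum_comp (fun x => Real.negMulLog (bern p x))).trans (sum_negMulLog_bern p)
  rw [Fintype.sum_prod_type, sum_sum_negMulLog_mul (sum_bern_sub p a) (sum_bern_sub p b), h, h]
  ring

theorem xorSource_prob_triple (p : ℝ) (hp : p ∈ Set.Icc (0 : ℝ) 1) (a b c : ZMod 2) :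
    (xorSource p hp).prob ![a, b, c] = if c = a + b then bern p a * bern p b else 0 := rfl

theorem sum_negMulLog_xorSource (p : ℝ) (hp : p ∈ Set.Icc (0 : ℝ) 1) :
    ∑ s, Real.negMulLog ((xorSource p hp).prob s) = 2 * Real.binEntropy p := by
  rw [sum_pi_three]
  simp only [xorSource_prob_triple]
  have : ∀ a b : ZMod 2, ∑ c, Real.negMulLog (if c = a + b then bern p a * bern p b else 0)
      = Real.negMulLog (bern p a * bern p b) := fun a b => by
    rw [Finset.sum_eq_single (a + b)] <;> simp +contextual
  simp only [this]
  rw [sum_sum_negMulLog_mul (sum_bern p) (sum_bern p), sum_negMulLog_bern]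
  ring

theorem sum_negMulLog_xorMAC_of_eq (δ : ℝ) (hδ : δ ∈ Set.Icc (0 : ℝ) 1) {x : Fin 3 → ZMod 2}
    (hx : x 2 = x 0 + x 1) :
    ∑ y, Real.negMulLog ((xorMAC δ hδ).prob x y) = 2 * Real.binEntropy δ := by
  simp only [xorMAC, if_pos hx]
  exact sum_negMulLog_bern_sub_mul δ _ _

theorem sum_negMulLog_xorMAC_of_ne (δ : ℝ) (hδ : δ ∈ Set.Icc (0 : ℝ) 1) {x : Fin 3 → ZMod 2}
    (hx : x 2 ≠ x 0 + x 1) :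
    ∑ y, Real.negMulLog ((xorMAC δ hδ).prob x y) = 2 * Real.log 2 := by
  simp only [xorMAC, if_neg hx]
  have := sum_negMulLog_bern_sub_mul (1 / 2) 0 0
  simpa using this

theorem le_sum_negMulLog_xorMAC (δ : ℝ) (hδ : δ ∈ Set.Icc (0 : ℝ) 1) (x : Fin 3 → ZMod 2) :
    2 * Real.binEntropy δ ≤ ∑ y, Real.negMulLog ((xorMAC δ hδ).prob x y) := by
  by_cases hx : x 2 = x 0 + x 1
  · rw [sum_negMulLog_xorMAC_of_eq δ hδ hx]
  · rw [sum_negMulLog_xorMAC_of_ne δ hδ hx]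
    linarith [Real.binEntropy_le_log_two (p := δ)]

/-- Zero dispersion would make the source uniform on its support, but (0,0,0) and (1,1,0) have
masses (1 - p)² and p². -/
theorem dispersion_xorSource_pos {p : ℝ} (hp : p ∈ Set.Icc (0 : ℝ) 1) (h0 : 0 < p) (h1 : p < 1)
    (h2 : p ≠ 1 / 2) :
    0 < ∑ s, (xorSource p hp).prob s * infoDev (xorSource p hp).prob s ^ 2 := by
  set P := xorSource p hp
  have hnn : ∀ s ∈ (univ : Finset (Fin 3 → ZMod 2)), 0 ≤ P.prob s * infoDev P.prob s ^ 2 :=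
    fun s _ => mul_nonneg (P.mem_simplex.1 s) (sq_nonneg _)
  refine lt_of_le_of_ne (Finset.sum_nonneg hnn) fun h => ?_
  have hz := (Finset.sum_eq_zero_iff_of_nonneg hnn).1 h.symm
  have e0 : P.prob ![0, 0, 0] = (1 - p) * (1 - p) := by simp [P, xorSource, bern]
  have e1 : P.prob ![1, 1, 0] = p * p := by
    have : (0 : ZMod 2) = 1 + 1 := rfl
    simp [P, xorSource, bern, this]
  have z0 := hz ![0, 0, 0] (mem_univ _)
  have z1 := hz ![1, 1, 0] (mem_univ _)
  have p0 : 0 < 1 - p := by linarith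
  rw [mul_eq_zero, or_iff_right (by rw [e0]; positivity), sq_eq_zero_iff, infoDev, e0] at z0
  rw [mul_eq_zero, or_iff_right (by rw [e1]; positivity), sq_eq_zero_iff, infoDev, e1] at z1
  have hl : Real.log ((1 - p) * (1 - p)) = Real.log (p * p) := by linarith
  have := Real.log_injOn_pos (Set.mem_Ioi.2 (by positivity)) (Set.mem_Ioi.2 (by positivity)) hl
  apply h2
  nlinarith

theorem log_card_output : Real.log (Fintype.card (ZMod 2 × ZMod 2)) = 2 * Real.log 2 := by
  have h : (Fintype.card (ZMod 2 × ZMod 2) : ℝ) = 2 ^ 2 := by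
    rw [Fintype.card_prod, ZMod.card]; norm_num
  rw [h, Real.log_pow]
  norm_num

end XorEntropies

/-! ### Random linear codes -/

section Linear

/-- For v ≠ 0 evaluation at v is a surjective homomorphism, so its fibres are equinumerous. In other
words, Av is uniform when A is uniform. -/
theorem card_mulVec_fiber {n : ℕ} {v : Fin n → ZMod 2} (hv : v ≠ 0) (w : Fin n → ZMod 2) :
    (#{A : Matrix (Fin n) (Fin n) (ZMod 2) | A.mulVec v = w} : ℝ) * 2 ^ n
      = Fintype.card (Matrix (Fin n) (Fin n) (ZMod 2)) := by
  obtain ⟨j, hj⟩ := Function.ne_iff.1 hv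
  have hj1 : v j = 1 := by
    have : ∀ a : ZMod 2, a ≠ 0 → a = 1 := by decide
    exact this _ hj
  let f : Matrix (Fin n) (Fin n) (ZMod 2) →+ (Fin n → ZMod 2) :=
    { toFun := fun A => A.mulVec v
      map_zero' := Matrix.zero_mulVec v
      map_add' := fun A B => Matrix.add_mulVec A B v }
  have hsurj : ∀ w, w ∈ Set.range f := fun w => by
    refine ⟨Matrix.of fun i k => if k = j then w i else 0, ?_⟩
    ext i
    simp [f, Matrix.mulVec, dotProduct, hj1]
  have hfib : ∀ w', #{A | f A = w'} = #{A | f A = w} := fun w' =>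
    AddMonoidHom.card_fiber_eq_of_mem_range f (hsurj w') (hsurj w)
  have := Finset.card_eq_sum_card_fiberwise (f := f) (s := univ) (t := univ)
    (fun _ _ => mem_coe.2 (mem_univ _))
  rw [Finset.sum_congr rfl fun w' _ => hfib w', Finset.sum_const, smul_eq_mul, Finset.card_univ,
    Finset.card_univ, Fintype.card_fun, ZMod.card, Fintype.card_fin] at this
  rw [this]
  push_cast
  rw [mul_comm]
  rfl

/-- Sequences of probability at least `exp (-n (H(p) + κ))` under the i.i.d. Bernoulli law. -/
noncomputable def typicalSet (p κ : ℝ) (n : ℕ) : Finset (Fin n → ZMod 2) :=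
  {v | Real.exp (-(n * (Real.binEntropy p + κ))) ≤ ∏ t, bern p (v t)}

theorem sum_block_bern (p : ℝ) (n : ℕ) : ∑ v : Fin n → ZMod 2, ∏ t, bern p (v t) = 1 :=
  sum_pi_prod_eq_one (fun _ => bern p) fun _ => sum_bern p

theorem block_bern_nonneg {p : ℝ} (hp : p ∈ Set.Icc (0 : ℝ) 1) {n : ℕ} (v : Fin n → ZMod 2) :
    0 ≤ ∏ t, bern p (v t) :=
  prod_nonneg fun _ _ => bern_nonneg hp _

theorem card_typicalSet_le {p : ℝ} (hp : p ∈ Set.Icc (0 : ℝ) 1) (κ : ℝ) (n : ℕ) :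
    (#(typicalSet p κ n) : ℝ) ≤ Real.exp (n * (Real.binEntropy p + κ)) := by
  have h : #(typicalSet p κ n) • Real.exp (-(n * (Real.binEntropy p + κ))) ≤ 1 := by
    rw [← sum_block_bern p n]
    refine (Finset.card_nsmul_le_sum _ _ _ fun v hv => (Finset.mem_filter.1 hv).2).trans ?_
    exact Finset.sum_le_sum_of_subset_of_nonneg (subset_univ _) fun v _ _ => block_bern_nonneg hp v
  rwa [nsmul_eq_mul, Real.exp_neg, ← div_eq_mul_inv, div_le_one (Real.exp_pos _)] at h

theorem exists_sum_not_typical_le {p : ℝ} (hp : p ∈ Set.Icc (0 : ℝ) 1) {κ : ℝ} (hκ : 0 < κ) :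
    ∃ C : ℝ, ∀ n : ℕ, 0 < n →
      ∑ v : Fin n → ZMod 2 with v ∉ typicalSet p κ n, ∏ t, bern p (v t) ≤ C / n := by
  set M := ∑ a, |infoDev (bern p) a| with hM
  have hMle : ∀ a, |infoDev (bern p) a| ≤ M := fun a =>
    single_le_sum (fun a _ => abs_nonneg (infoDev (bern p) a)) (mem_univ a)
  refine ⟨M ^ 2 / κ ^ 2, fun n hn => ?_⟩
  have hn' : (0 : ℝ) < n := by exact_mod_cast hn
  have h := sum_filter_le_div_sq (fun v : Fin n → ZMod 2 => ∏ t, bern p (v t))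
    (fun v => ∑ t, infoDev (bern p) (v t)) (fun v => block_bern_nonneg hp v) (c := n * κ)
    (by positivity) (sum_pi_prod_mul_sum_sq_le (fun _ => bern p) (fun _ => infoDev (bern p))
      (fun _ => bern_nonneg hp) (fun _ => sum_bern p) (fun _ => sum_mul_infoDev (sum_bern p))
      (fun _ => hMle))
  have e : n * M ^ 2 / (n * κ) ^ 2 = M ^ 2 / κ ^ 2 / n := by field_simp
  rw [e] at h
  refine le_trans ?_ h
  rw [Finset.sum_filter, Finset.sum_filter]
  refine Finset.sum_le_sum fun v _ => ?_
  -- The density formula needs nonzero mass, since `Real.log 0 = 0`; blocks of mass zero contribute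
  -- nothing to either sum.
  by_cases hv : ∏ t, bern p (v t) = 0
  · simp [hv]
  by_cases h1 : v ∈ typicalSet p κ n
  · rw [if_neg (not_not.2 h1)]
    split_ifs
    · exact block_bern_nonneg hp v
    · exact le_rfl
  · rw [if_pos h1, if_pos]
    simp only [typicalSet, Finset.mem_filter, Finset.mem_univ, true_and, not_le] at h1
    rw [prod_eq_exp_infoDev (fun _ => bern p) (fun _ => bern_nonneg hp) v hv,
      Real.exp_lt_exp] at h1
    simp only [sum_negMulLog_bern, Finset.sum_const, Finset.card_univ, Fintype.card_fin,
      nsmul_eq_mul] at h1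
    refine le_trans ?_ (le_abs_self (∑ t, infoDev (bern p) (v t)))
    linarith

/-- Error probability of a single user who sends `g s` over a channel with additive noise. -/
noncomputable def additiveError (p δ : ℝ) {n : ℕ}
    (g D : (Fin n → ZMod 2) → (Fin n → ZMod 2)) : ℝ :=
  ∑ s : Fin n → ZMod 2, ∑ y : Fin n → ZMod 2,
    (∏ t, bern p (s t)) * (∏ t, bern δ (y t - g s t)) * if D y ≠ s then 1 else 0

open Classical in
/-- Typical-set decoding for the linear code with matrix `A`. -/
noncomputable def typicalDecoder {n : ℕ} (T T' : Finset (Fin n → ZMod 2))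
    (A : Matrix (Fin n) (Fin n) (ZMod 2)) (y : Fin n → ZMod 2) : Fin n → ZMod 2 :=
  if h : ∃ s ∈ T, y - A.mulVec s ∈ T' then h.choose else 0

/-- A pointwise union bound: with s and z both typical, the decoder can only err through a typical
competitor. The matrix enters the bound only through its value on the nonzero difference s - s',
which is what averaging over matrices can exploit. -/
theorem typicalDecoder_ne_le {n : ℕ} (T T' : Finset (Fin n → ZMod 2))
    (A : Matrix (Fin n) (Fin n) (ZMod 2)) (s z : Fin n → ZMod 2) :
    (if typicalDecoder T T' A (z + A.mulVec s) ≠ s then (1 : ℝ) else 0) ≤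
      (if s ∉ T then 1 else 0) + (if z ∉ T' then 1 else 0) +
        ∑ s' ∈ T with s' ≠ s, if A.mulVec (s - s') + z ∈ T' then 1 else 0 := by
  have hnn : (0 : ℝ) ≤ ∑ s' ∈ T with s' ≠ s, if A.mulVec (s - s') + z ∈ T' then 1 else 0 :=
    Finset.sum_nonneg fun _ _ => by split_ifs <;> norm_num
  by_cases hs : s ∈ T
  swap
  · rw [if_pos (show s ∉ T from hs)]
    split_ifs <;> linarith
  by_cases hz : z ∈ T'
  swap
  · rw [if_pos (show z ∉ T' from hz)]
    split_ifs <;> linarith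
  rw [if_neg (not_not.2 hs), if_neg (not_not.2 hz)]
  split_ifs with hD
  swap
  · linarith
  have hex : ∃ s' ∈ T, z + A.mulVec s - A.mulVec s' ∈ T' := ⟨s, hs, by simpa using hz⟩
  rw [typicalDecoder, dif_pos hex] at hD
  obtain ⟨h1, h2⟩ := hex.choose_spec
  have h3 := single_le_sum (f := fun s' => if A.mulVec (s - s') + z ∈ T' then (1 : ℝ) else 0)
    (s := T.filter fun s' => s' ≠ s) (fun _ _ => by split_ifs <;> norm_num)
    (Finset.mem_filter.2 ⟨h1, hD⟩)
  have h4 : A.mulVec (s - hex.choose) + z ∈ T' := by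
    rw [Matrix.mulVec_sub]
    convert h2 using 1
    abel
  rw [if_pos h4] at h3
  linarith

theorem additiveError_typicalDecoder_le {p δ : ℝ} (hp : p ∈ Set.Icc (0 : ℝ) 1)
    (hδ : δ ∈ Set.Icc (0 : ℝ) 1) {n : ℕ} (T T' : Finset (Fin n → ZMod 2))
    (A : Matrix (Fin n) (Fin n) (ZMod 2)) :
    additiveError p δ A.mulVec (typicalDecoder T T' A) ≤
      (∑ s with s ∉ T, ∏ t, bern p (s t)) + (∑ z with z ∉ T', ∏ t, bern δ (z t)) +
      ∑ s : Fin n → ZMod 2, ∑ z : Fin n → ZMod 2, (∏ t, bern p (s t)) * (∏ t, bern δ (z t)) *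
        ∑ s' ∈ T with s' ≠ s, if A.mulVec (s - s') + z ∈ T' then 1 else 0 := by
  calc additiveError p δ A.mulVec (typicalDecoder T T' A)
      = ∑ s : Fin n → ZMod 2, ∑ z : Fin n → ZMod 2, (∏ t, bern p (s t)) * (∏ t, bern δ (z t)) *
        if typicalDecoder T T' A (z + A.mulVec s) ≠ s then 1 else 0 := by
        refine Finset.sum_congr rfl fun s _ => ?_
        rw [← Equiv.sum_comp (Equiv.addRight (A.mulVec s))]
        refine Finset.sum_congr rfl fun z _ => ?_
        simp only [Equiv.coe_addRight, Pi.add_apply, add_sub_cancel_right]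
        congr
    _ ≤ ∑ s : Fin n → ZMod 2, ∑ z : Fin n → ZMod 2, (∏ t, bern p (s t)) * (∏ t, bern δ (z t)) *
        ((if s ∉ T then 1 else 0) + (if z ∉ T' then 1 else 0) +
        ∑ s' ∈ T with s' ≠ s, if A.mulVec (s - s') + z ∈ T' then 1 else 0) := by
        refine Finset.sum_le_sum fun s _ => Finset.sum_le_sum fun z _ =>
          mul_le_mul_of_nonneg_left (typicalDecoder_ne_le T T' A s z)
            (mul_nonneg (block_bern_nonneg hp s) (block_bern_nonneg hδ z))
    _ = (∑ s : Fin n → ZMod 2, (∏ t, bern p (s t)) * if s ∉ T then 1 else 0) *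
          (∑ z : Fin n → ZMod 2, ∏ t, bern δ (z t)) +
        (∑ s : Fin n → ZMod 2, ∏ t, bern p (s t)) *
          (∑ z : Fin n → ZMod 2, (∏ t, bern δ (z t)) * if z ∉ T' then 1 else 0) +
        ∑ s : Fin n → ZMod 2, ∑ z : Fin n → ZMod 2, (∏ t, bern p (s t)) * (∏ t, bern δ (z t)) *
        ∑ s' ∈ T with s' ≠ s, if A.mulVec (s - s') + z ∈ T' then 1 else 0 := by
        rw [Finset.sum_mul_sum, Finset.sum_mul_sum, ← Finset.sum_add_distrib,
          ← Finset.sum_add_distrib]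
        refine Finset.sum_congr rfl fun s _ => ?_
        rw [← Finset.sum_add_distrib, ← Finset.sum_add_distrib]
        exact Finset.sum_congr rfl fun z _ => by ring
    _ = _ := by
        rw [sum_block_bern, sum_block_bern, mul_one, one_mul, Finset.sum_filter, Finset.sum_filter]
        simp only [mul_ite, mul_one, mul_zero]

/-- For s' ≠ s the vector A(s - s') + z is uniform over the random matrix, so it hits T' with
probability |T'| / 2ⁿ; sum over the competitors in T. -/
theorem sum_matrix_collision_le {p δ : ℝ} (hp : p ∈ Set.Icc (0 : ℝ) 1)
    (hδ : δ ∈ Set.Icc (0 : ℝ) 1) {n : ℕ} (T T' : Finset (Fin n → ZMod 2)) :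
    ∑ A : Matrix (Fin n) (Fin n) (ZMod 2),
      ∑ s : Fin n → ZMod 2, ∑ z : Fin n → ZMod 2, (∏ t, bern p (s t)) * (∏ t, bern δ (z t)) *
        ∑ s' ∈ T with s' ≠ s, (if A.mulVec (s - s') + z ∈ T' then (1 : ℝ) else 0) ≤
      Fintype.card (Matrix (Fin n) (Fin n) (ZMod 2)) * (#T * #T' / 2 ^ n) := by
  set m : ℝ := ((Fintype.card (Matrix (Fin n) (Fin n) (ZMod 2)) : ℕ) : ℝ) with hm
  have hcount : ∀ v z : Fin n → ZMod 2, v ≠ 0 →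
      ∑ A : Matrix (Fin n) (Fin n) (ZMod 2), (if A.mulVec v + z ∈ T' then (1 : ℝ) else 0)
        = m * #T' / 2 ^ n := by
    intro v z hv
    have h1 : ∀ A : Matrix (Fin n) (Fin n) (ZMod 2),
        (if A.mulVec v + z ∈ T' then (1 : ℝ) else 0) =
          ∑ z' ∈ T', if A.mulVec v = z' - z then 1 else 0 := fun A => by
      simp only [eq_sub_iff_add_eq, Finset.sum_ite_eq]
    simp only [h1]
    rw [Finset.sum_comm]
    have h2 : ∀ w : Fin n → ZMod 2,
        ∑ A : Matrix (Fin n) (Fin n) (ZMod 2), (if A.mulVec v = w then (1 : ℝ) else 0)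
          = m / 2 ^ n := fun w => by
      rw [Finset.sum_boole, eq_div_iff (by positivity), card_mulVec_fiber hv]
    rw [Finset.sum_congr rfl fun z' _ => h2 (z' - z), Finset.sum_const, nsmul_eq_mul]
    ring
  have hm0 : 0 ≤ m := Nat.cast_nonneg _
  rw [Finset.sum_comm]
  calc _ = ∑ s : Fin n → ZMod 2, ∑ z : Fin n → ZMod 2, (∏ t, bern p (s t)) * (∏ t, bern δ (z t)) *
        ∑ s' ∈ T with s' ≠ s, ∑ A : Matrix (Fin n) (Fin n) (ZMod 2),
          (if A.mulVec (s - s') + z ∈ T' then (1 : ℝ) else 0) := by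
        refine Finset.sum_congr rfl fun s _ => ?_
        rw [Finset.sum_comm]
        refine Finset.sum_congr rfl fun z _ => ?_
        rw [← Finset.mul_sum, Finset.sum_comm]
    _ ≤ ∑ s : Fin n → ZMod 2, ∑ z : Fin n → ZMod 2, (∏ t, bern p (s t)) * (∏ t, bern δ (z t)) *
        (m * (#T * #T' / 2 ^ n)) := by
        refine Finset.sum_le_sum fun s _ => Finset.sum_le_sum fun z _ =>
          mul_le_mul_of_nonneg_left ?_ (mul_nonneg (block_bern_nonneg hp s) (block_bern_nonneg hδ z))
        rw [Finset.sum_congr rfl fun s' hs' =>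
          hcount (s - s') z (sub_ne_zero.2 (Finset.mem_filter.1 hs').2.symm), Finset.sum_const,
          nsmul_eq_mul]
        calc _ ≤ (#T : ℝ) * (m * #T' / 2 ^ n) := by
              gcongr
              exact Finset.filter_subset _ _
          _ = _ := by ring
    _ = (∑ s : Fin n → ZMod 2, ∏ t, bern p (s t)) * (∑ z : Fin n → ZMod 2, ∏ t, bern δ (z t)) *
        (m * (#T * #T' / 2 ^ n)) := by
        rw [Finset.sum_mul_sum, Finset.sum_mul]
        simp only [Finset.sum_mul]
    _ = _ := by rw [sum_block_bern, sum_block_bern]; ring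

theorem exists_additiveError_le {p δ : ℝ} (hp : p ∈ Set.Icc (0 : ℝ) 1)
    (hδ : δ ∈ Set.Icc (0 : ℝ) 1) (h : Real.binEntropy p + Real.binEntropy δ < Real.log 2)
    {ε : ℝ} (hε : 0 < ε) : ∃ N : ℕ, ∀ n : ℕ, N ≤ n →
      ∃ (A : Matrix (Fin n) (Fin n) (ZMod 2)) (D : (Fin n → ZMod 2) → (Fin n → ZMod 2)),
        additiveError p δ A.mulVec D ≤ ε := by
  -- A quarter of the entropy gap: the two typical sets spend 2κ of the gap 4κ, and the exponent 2κ
  -- remains for the collision bound.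
  set κ := (Real.log 2 - (Real.binEntropy p + Real.binEntropy δ)) / 4 with hκ
  have hκ0 : 0 < κ := by rw [hκ]; linarith
  obtain ⟨C, hC⟩ := exists_sum_not_typical_le hp hκ0
  obtain ⟨C', hC'⟩ := exists_sum_not_typical_le hδ hκ0
  have hl : Filter.Tendsto (fun n : ℕ => C / n + C' / n + Real.exp (-(n * (2 * κ))))
      Filter.atTop (nhds 0) := by
    have h1 : Filter.Tendsto (fun n : ℕ => Real.exp (-(n * (2 * κ)))) Filter.atTop (nhds 0) :=
      Real.tendsto_exp_neg_atTop_nhds_zero.comp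
        (tendsto_natCast_atTop_atTop.atTop_mul_const (by positivity))
    simpa using ((tendsto_const_div_atTop_nhds_zero_nat C).add
      (tendsto_const_div_atTop_nhds_zero_nat C')).add h1
  obtain ⟨N, hN⟩ := Filter.eventually_atTop.1
    ((hl.eventually_lt_const hε).and (Filter.eventually_gt_atTop 0))
  refine ⟨N, fun n hn => ?_⟩
  obtain ⟨hlt, hn0⟩ := hN n hn
  set T := typicalSet p κ n
  set T' := typicalSet δ κ n
  have hcol : (#T * #T' / 2 ^ n : ℝ) ≤ Real.exp (-(n * (2 * κ))) := by
    rw [div_le_iff₀ (by positivity)]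
    have e2 : (2 : ℝ) ^ n = Real.exp (n * Real.log 2) := by
      rw [Real.exp_nat_mul, Real.exp_log (by norm_num)]
    rw [e2, ← Real.exp_add]
    refine (mul_le_mul (card_typicalSet_le hp κ n) (card_typicalSet_le hδ κ n)
      (Nat.cast_nonneg _) (Real.exp_pos _).le).trans ?_
    rw [← Real.exp_add]
    refine Real.exp_le_exp.2 (le_of_eq ?_)
    rw [hκ]; ring
  -- The atypicality terms do not involve the matrix, so only the collision term has to be averaged.
  have havg : ∃ A ∈ (univ : Finset (Matrix (Fin n) (Fin n) (ZMod 2))),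
      ∑ s : Fin n → ZMod 2, ∑ z : Fin n → ZMod 2, (∏ t, bern p (s t)) * (∏ t, bern δ (z t)) *
        ∑ s' ∈ T with s' ≠ s, (if A.mulVec (s - s') + z ∈ T' then (1 : ℝ) else 0)
        ≤ #T * #T' / 2 ^ n := by
    refine Finset.exists_le_of_sum_le univ_nonempty ?_
    rw [Finset.sum_const, nsmul_eq_mul]
    exact sum_matrix_collision_le hp hδ T T'
  obtain ⟨A, -, hA⟩ := havg
  refine ⟨A, typicalDecoder T T' A, ?_⟩
  have h1 := additiveError_typicalDecoder_le hp hδ T T' A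
  have h2 := hC n hn0
  have h3 := hC' n hn0
  linarith

end Linear

/-! ### Transmissibility of the additive source -/

section Transmissibility

/-- The three-user decoder that decodes the first two blocks separately and adds the results. -/
def addDecoder {n : ℕ} (D : (Fin n → ZMod 2) → (Fin n → ZMod 2))
    (y : Fin n → ZMod 2 × ZMod 2) : Fin 3 → Fin n → ZMod 2 :=
  ![D fun t => (y t).1, D fun t => (y t).2, (D fun t => (y t).1) + D fun t => (y t).2]

theorem prod_xorSource {p : ℝ} (hp : p ∈ Set.Icc (0 : ℝ) 1) {n : ℕ} (s : Fin 3 → Fin n → ZMod 2) :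
    ∏ t, (xorSource p hp).prob (fun i => s i t) =
      if s 2 = s 0 + s 1 then (∏ t, bern p (s 0 t)) * ∏ t, bern p (s 1 t) else 0 := by
  split_ifs with h
  · rw [← Finset.prod_mul_distrib]
    exact Finset.prod_congr rfl fun t _ => if_pos (congrFun h t)
  · obtain ⟨t, ht⟩ := Function.ne_iff.1 h
    exact Finset.prod_eq_zero (mem_univ t) (if_neg ht)

theorem sum_ite_add_eq {α : Type*} [Fintype α] [DecidableEq α] [Add α] (F : (Fin 3 → α) → ℝ) :
    (∑ s : Fin 3 → α, if s 2 = s 0 + s 1 then F s else 0) = ∑ a, ∑ b, F ![a, b, a + b] := by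
  rw [sum_pi_three]
  refine Finset.sum_congr rfl fun a _ => Finset.sum_congr rfl fun b _ => ?_
  rw [Finset.sum_eq_single (a + b)]
  · exact if_pos rfl
  · exact fun c _ hc => if_neg hc
  · exact fun h => absurd (mem_univ _) h

open Classical in
theorem errorProb_addDecoder_eq {p δ : ℝ} (hp : p ∈ Set.Icc (0 : ℝ) 1)
    (hδ : δ ∈ Set.Icc (0 : ℝ) 1) {n : ℕ} (g D : (Fin n → ZMod 2) → (Fin n → ZMod 2)) :
    errorProb (xorSource p hp) (xorMAC δ hδ) n (fun _ => g) (addDecoder D) =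
      ∑ a : Fin n → ZMod 2, ∑ b : Fin n → ZMod 2, ((∏ t, bern p (a t)) * ∏ t, bern p (b t)) *
        ∑ y : Fin n → ZMod 2 × ZMod 2 with addDecoder D y ≠ ![a, b, a + b],
          ∏ t, (xorMAC δ hδ).prob (fun i => g (![a, b, a + b] i) t) (y t) := by
  let G : (Fin 3 → Fin n → ZMod 2) → ℝ := fun s =>
    ∑ y : Fin n → ZMod 2 × ZMod 2 with addDecoder D y ≠ s,
      ∏ t, (xorMAC δ hδ).prob (fun i => g (s i) t) (y t)
  have h : errorProb (xorSource p hp) (xorMAC δ hδ) n (fun _ => g) (addDecoder D) =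
      ∑ s : Fin 3 → Fin n → ZMod 2, (∏ t, (xorSource p hp).prob (fun i => s i t)) * G s := by
    unfold errorProb
    refine Finset.sum_congr rfl fun s _ => congrArg _ (Finset.sum_congr ?_ fun _ _ => rfl)
    ext y
    simp
  rw [h]
  have h2 : ∀ s : Fin 3 → Fin n → ZMod 2, (∏ t, (xorSource p hp).prob (fun i => s i t)) * G s =
      if s 2 = s 0 + s 1 then (∏ t, bern p (s 0 t)) * (∏ t, bern p (s 1 t)) * G s else 0 :=
    fun s => by rw [prod_xorSource hp s, ite_mul, zero_mul]
  rw [Finset.sum_congr rfl fun s _ => h2 s,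
    sum_ite_add_eq fun s : Fin 3 → Fin n → ZMod 2 => (∏ t, bern p (s 0 t)) * (∏ t, bern p (s 1 t)) * G s]
  rfl

-- Additivity of g keeps the three inputs on the parity constraint in every slot, so the channel
-- factors into two additive-noise channels. The third decoded block is the sum of the first two,
-- hence any error is already an error in one of these.
open Classical in
theorem sum_channel_addDecoder_le {δ : ℝ} (hδ : δ ∈ Set.Icc (0 : ℝ) 1) {n : ℕ}
    (g D : (Fin n → ZMod 2) → (Fin n → ZMod 2)) (hg : ∀ a b, g (a + b) = g a + g b)
    (a b : Fin n → ZMod 2) :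
    (∑ y : Fin n → ZMod 2 × ZMod 2 with addDecoder D y ≠ ![a, b, a + b],
        ∏ t, (xorMAC δ hδ).prob (fun i => g (![a, b, a + b] i) t) (y t)) ≤
      ∑ y₁ : Fin n → ZMod 2, ∑ y₂ : Fin n → ZMod 2,
        (∏ t, bern δ (y₁ t - g a t)) * (∏ t, bern δ (y₂ t - g b t)) *
          ((if D y₁ ≠ a then 1 else 0) + (if D y₂ ≠ b then 1 else 0)) := by
  rw [Finset.sum_filter, ← Equiv.sum_comp
    (Equiv.arrowProdEquivProdArrow (Fin n) (fun _ => ZMod 2) (fun _ => ZMod 2)).symm,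
    Fintype.sum_prod_type]
  refine Finset.sum_le_sum fun y₁ _ => Finset.sum_le_sum fun y₂ _ => ?_
  have hprod : ∏ t, (xorMAC δ hδ).prob (fun i => g (![a, b, a + b] i) t)
      ((Equiv.arrowProdEquivProdArrow (Fin n) (fun _ => ZMod 2) (fun _ => ZMod 2)).symm
        (y₁, y₂) t) = (∏ t, bern δ (y₁ t - g a t)) * (∏ t, bern δ (y₂ t - g b t)) := by
    rw [← Finset.prod_mul_distrib]
    exact Finset.prod_congr rfl fun t _ => if_pos (congrFun (hg a b) t)
  rw [hprod]
  have hnn : 0 ≤ (∏ t, bern δ (y₁ t - g a t)) * (∏ t, bern δ (y₂ t - g b t)) :=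
    mul_nonneg (prod_nonneg fun _ _ => bern_nonneg hδ _) (prod_nonneg fun _ _ => bern_nonneg hδ _)
  by_cases h1 : D y₁ = a
  · by_cases h2 : D y₂ = b
    · rw [if_neg, if_neg (not_not.2 h1), if_neg (not_not.2 h2)]
      · simp
      · rw [not_not]
        change ![D y₁, D y₂, D y₁ + D y₂] = _
        rw [h1, h2]
    · rw [if_neg (not_not.2 h1), if_pos h2, zero_add, mul_one]
      split_ifs
      · exact le_rfl
      · exact hnn
  · rw [if_pos h1]
    have : (1 : ℝ) ≤ 1 + if D y₂ ≠ b then 1 else 0 := by split_ifs <;> norm_num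
    refine le_trans ?_ (le_mul_of_one_le_right hnn this)
    split_ifs
    · exact le_rfl
    · exact hnn

/-- Reduces the three-user problem to one additive-noise link used twice, by a union bound over the
two independent links. -/
theorem errorProb_addDecoder_le {p δ : ℝ} (hp : p ∈ Set.Icc (0 : ℝ) 1)
    (hδ : δ ∈ Set.Icc (0 : ℝ) 1) {n : ℕ} (g D : (Fin n → ZMod 2) → (Fin n → ZMod 2))
    (hg : ∀ a b, g (a + b) = g a + g b) :
    errorProb (xorSource p hp) (xorMAC δ hδ) n (fun _ => g) (addDecoder D) ≤
      2 * additiveError p δ g D := by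
  classical
  have hone : ∀ c : Fin n → ZMod 2, ∑ y : Fin n → ZMod 2, ∏ t, bern δ (y t - g c t) = 1 :=
    fun c => sum_pi_prod_eq_one (fun t x => bern δ (x - g c t)) fun t => sum_bern_sub δ _
  let E : (Fin n → ZMod 2) → ℝ := fun a =>
    ∑ y : Fin n → ZMod 2, (∏ t, bern δ (y t - g a t)) * if D y ≠ a then 1 else 0
  have hE : additiveError p δ g D = ∑ a : Fin n → ZMod 2, (∏ t, bern p (a t)) * E a := by
    refine Finset.sum_congr rfl fun a _ => ?_
    simp only [E]
    rw [Finset.mul_sum]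
    exact Finset.sum_congr rfl fun y _ => by rw [mul_assoc]
  rw [errorProb_addDecoder_eq]
  calc _ ≤ ∑ a : Fin n → ZMod 2, ∑ b : Fin n → ZMod 2, ((∏ t, bern p (a t)) * ∏ t, bern p (b t)) *
        (E a + E b) := by
        refine Finset.sum_le_sum fun a _ => Finset.sum_le_sum fun b _ =>
          mul_le_mul_of_nonneg_left ?_
            (mul_nonneg (block_bern_nonneg hp a) (block_bern_nonneg hp b))
        refine (sum_channel_addDecoder_le hδ g D hg a b).trans (le_of_eq ?_)
        calc _ = E a * (∑ y : Fin n → ZMod 2, ∏ t, bern δ (y t - g b t)) +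
              (∑ y : Fin n → ZMod 2, ∏ t, bern δ (y t - g a t)) * E b := by
              simp only [E]
              rw [Finset.sum_mul_sum, Finset.sum_mul_sum, ← Finset.sum_add_distrib]
              refine Finset.sum_congr rfl fun y₁ _ => ?_
              rw [← Finset.sum_add_distrib]
              refine Finset.sum_congr rfl fun y₂ _ => ?_
              rw [mul_add]
              congr 1
              · rw [mul_right_comm]
              · rw [mul_assoc]
          _ = _ := by rw [hone, hone, one_mul, mul_one]
    _ = (∑ a : Fin n → ZMod 2, (∏ t, bern p (a t)) * E a) *
          (∑ b : Fin n → ZMod 2, ∏ t, bern p (b t)) +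
        (∑ a : Fin n → ZMod 2, ∏ t, bern p (a t)) *
          ∑ b : Fin n → ZMod 2, (∏ t, bern p (b t)) * E b := by
        rw [Finset.sum_mul_sum, Finset.sum_mul_sum, ← Finset.sum_add_distrib]
        refine Finset.sum_congr rfl fun a _ => ?_
        rw [← Finset.sum_add_distrib]
        exact Finset.sum_congr rfl fun b _ => by ring
    _ = _ := by rw [sum_block_bern, ← hE]; ring

theorem transmissible_of_lt {p δ : ℝ} (hp : p ∈ Set.Icc (0 : ℝ) 1) (hδ : δ ∈ Set.Icc (0 : ℝ) 1)
    (h : Real.binEntropy p + Real.binEntropy δ < Real.log 2) :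
    Transmissible (xorSource p hp) (xorMAC δ hδ) := by
  intro ε hε
  obtain ⟨N, hN⟩ := exists_additiveError_le hp hδ h (half_pos hε)
  refine ⟨N, fun n hn => ?_⟩
  obtain ⟨A, D, hAD⟩ := hN n hn
  refine ⟨fun _ => A.mulVec, addDecoder D, ?_⟩
  have := errorProb_addDecoder_le hp hδ A.mulVec D (Matrix.mulVec_add A)
  linarith

/-- A deterministic noise sequence can be removed without error. -/
theorem transmissible_of_noiseless {p δ : ℝ} (hp : p ∈ Set.Icc (0 : ℝ) 1)
    (hδ : δ ∈ Set.Icc (0 : ℝ) 1) (c : ZMod 2) (hc : ∀ x, x ≠ c → bern δ x = 0) :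
    Transmissible (xorSource p hp) (xorMAC δ hδ) := by
  intro ε hε
  refine ⟨0, fun n _ => ⟨fun _ => id, addDecoder fun y t => y t - c, ?_⟩⟩
  refine (errorProb_addDecoder_le hp hδ id (fun y t => y t - c) fun _ _ => rfl).trans ?_
  have : additiveError p δ (n := n) id (fun y t => y t - c) = 0 := by
    refine Finset.sum_eq_zero fun s _ => Finset.sum_eq_zero fun y _ => ?_
    split_ifs with h
    · obtain ⟨t, ht⟩ := Function.ne_iff.1 h
      rw [Finset.prod_eq_zero (f := fun t => bern δ (y t - id s t)) (mem_univ t), mul_zero,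
        zero_mul]
      refine hc _ fun h' => ht ?_
      exact sub_eq_of_eq_add' (sub_eq_iff_eq_add.1 h')
    · rw [mul_zero]
  rw [this, mul_zero]
  exact hε.le

/-- A deterministic source needs no channel. -/
theorem transmissible_of_deterministic {p δ : ℝ} (hp : p ∈ Set.Icc (0 : ℝ) 1)
    (hδ : δ ∈ Set.Icc (0 : ℝ) 1) (c : ZMod 2) (hc : ∀ x, x ≠ c → bern p x = 0) :
    Transmissible (xorSource p hp) (xorMAC δ hδ) := by
  intro ε hε
  refine ⟨0, fun n _ => ⟨fun _ _ => 0, addDecoder fun _ _ => c, ?_⟩⟩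
  refine (errorProb_addDecoder_le hp hδ (fun _ => 0) (fun _ _ => c) fun _ _ => by simp).trans ?_
  have : additiveError p δ (n := n) (fun _ => 0) (fun _ _ => c) = 0 := by
    refine Finset.sum_eq_zero fun s _ => Finset.sum_eq_zero fun y _ => ?_
    split_ifs with h
    · obtain ⟨t, ht⟩ := Function.ne_iff.1 h
      rw [Finset.prod_eq_zero (f := fun t => bern p (s t)) (mem_univ t) (hc _ ht.symm), zero_mul,
        zero_mul]
    · rw [mul_zero]
  rw [this, mul_zero]
  exact hε.le

theorem hb_lt_one_sub_hb_iff (p δ : ℝ) :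
    hb p < 1 - hb δ ↔ Real.binEntropy p + Real.binEntropy δ < Real.log 2 := by
  have h2 : 0 < Real.log 2 := Real.log_pos (by norm_num)
  unfold hb
  rw [lt_sub_iff_add_lt, ← add_div, div_lt_one h2]

theorem hb_eq_one_sub_hb_iff (p δ : ℝ) :
    hb p = 1 - hb δ ↔ Real.binEntropy p + Real.binEntropy δ = Real.log 2 := by
  have h2 : 0 < Real.log 2 := Real.log_pos (by norm_num)
  unfold hb
  rw [eq_sub_iff_add_eq, ← add_div, div_eq_one_iff_eq h2.ne']

/-- Here h(δ) lies strictly between 0 and log 2, hence so does h(p). At the critical rate the source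
is thus neither deterministic nor uniform, which both the dispersion argument and the CES argument
need. -/
theorem ne_of_binEntropy_add_eq {p δ : ℝ} (hδ : δ ∈ Set.Icc (0 : ℝ) 1) (hd0 : δ ≠ 0)
    (hd2 : δ ≠ 1 / 2) (hd1 : δ ≠ 1) (h : Real.binEntropy p + Real.binEntropy δ = Real.log 2) :
    p ≠ 0 ∧ p ≠ 1 / 2 ∧ p ≠ 1 := by
  have hδpos : 0 < Real.binEntropy δ :=
    Real.binEntropy_pos (lt_of_le_of_ne hδ.1 hd0.symm) (lt_of_le_of_ne hδ.2 hd1)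
  have hδlt : Real.binEntropy δ < Real.log 2 :=
    Real.binEntropy_lt_log_two.2 (by rwa [← one_div])
  refine ⟨?_, ?_, ?_⟩ <;>
  · rintro rfl
    simp at h
    linarith

theorem transmissible_xor_iff {p δ : ℝ} (hp : p ∈ Set.Icc (0 : ℝ) 1)
    (hδ : δ ∈ Set.Icc (0 : ℝ) 1) :
    Transmissible (xorSource p hp) (xorMAC δ hδ) ↔
      hb p < 1 - hb δ ∨ (hb p = 1 - hb δ ∧ (δ = 0 ∨ δ = 1 / 2 ∨ δ = 1)) := by
  rw [hb_lt_one_sub_hb_iff, hb_eq_one_sub_hb_iff]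
  constructor
  · intro hT
    rcases lt_trichotomy (Real.binEntropy p + Real.binEntropy δ) (Real.log 2) with h | h | h
    · exact Or.inl h
    · refine Or.inr ⟨h, ?_⟩
      by_contra! hne
      obtain ⟨hd0, hd2, hd1⟩ := hne
      obtain ⟨hp0, hp2, hp1⟩ := ne_of_binEntropy_add_eq hδ hd0 hd2 hd1 h
      refine not_transmissible_of_le (xorSource p hp) (xorMAC δ hδ)
        (le_sum_negMulLog_xorMAC δ hδ) ?_ (dispersion_xorSource_pos hp
        (lt_of_le_of_ne hp.1 hp0.symm) (lt_of_le_of_ne hp.2 hp1) hp2) hT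
      rw [log_card_output, sum_negMulLog_xorSource]
      linarith
    · refine absurd hT (not_transmissible_of_lt (xorSource p hp) (xorMAC δ hδ)
        (le_sum_negMulLog_xorMAC δ hδ) ?_)
      rw [log_card_output, sum_negMulLog_xorSource]
      linarith
  · have hz : ∀ x : ZMod 2, x ≠ 0 → bern 0 x = 0 := by
      intro x hx
      have : ∀ a : ZMod 2, a ≠ 0 → a = 1 := by decide
      simp [bern, this x hx]
    have ho : ∀ x : ZMod 2, x ≠ 1 → bern 1 x = 0 := by
      intro x hx
      simp [bern, hx]
    rintro (h | ⟨h, rfl | rfl | rfl⟩)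
    · exact transmissible_of_lt hp hδ h
    · exact transmissible_of_noiseless hp hδ 0 hz
    -- For δ = 1/2 the noise entropy is already log 2, so equality leaves only p = 0 and p = 1.
    · have : Real.binEntropy p = 0 := by simpa using h
      rcases Real.binEntropy_eq_zero.1 this with rfl | rfl
      · exact transmissible_of_deterministic hp hδ 0 hz
      · exact transmissible_of_deterministic hp hδ 1 ho
    · exact transmissible_of_noiseless hp hδ 1 ho

end Transmissibility

/-! ### Laws, entropies and Markov chains -/

section Laws

variable {Ω Ω' α β γ ζ : Type} [Fintype Ω] [Fintype Ω']

theorem law_comp (μ : Ω → ℝ) (π : Ω → Ω') (f : Ω' → α) (a : α) :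
    law μ (fun ω => f (π ω)) a = law (law μ π) f a := by
  classical
  simp only [law]
  rw [Finset.sum_filter, Finset.sum_filter]
  simp only [Finset.sum_filter]
  have h : ∀ ω', (if f ω' = a then ∑ ω, (if π ω = ω' then μ ω else 0) else 0) =
      ∑ ω, if π ω = ω' then (if f (π ω) = a then μ ω else 0) else 0 := fun ω' => by
    split_ifs with h
    · refine Finset.sum_congr rfl fun ω _ => ?_
      split_ifs with h1 h2
      · rfl
      · exact absurd (h1 ▸ h) h2
      · rfl
    · refine (Finset.sum_eq_zero fun ω _ => ?_).symm
      split_ifs with h1 h2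
      · exact absurd (h1 ▸ h2) h
      · rfl
      · rfl
  simp only [h]
  rw [Finset.sum_comm]
  simp

theorem law_congr {μ : Ω → ℝ} {X Y : Ω → α} (h : ∀ ω, μ ω ≠ 0 → X ω = Y ω) (a : α) :
    law μ X a = law μ Y a := by
  classical
  simp only [law]
  rw [Finset.sum_filter, Finset.sum_filter]
  refine Finset.sum_congr rfl fun ω _ => ?_
  by_cases h0 : μ ω = 0
  · simp [h0]
  · rw [h ω h0]

variable [Fintype α] [Fintype β] [Fintype γ] [Fintype ζ]

theorem entropy_comp (μ : Ω → ℝ) (π : Ω → Ω') (f : Ω' → α) :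
    entropy μ (fun ω => f (π ω)) = entropy (law μ π) f := by
  simp only [entropy, law_comp]

theorem condMutualInfo_comp (μ : Ω → ℝ) (π : Ω → Ω') (X : Ω' → α) (Y : Ω' → β) (Z : Ω' → γ) :
    condMutualInfo μ (fun ω => X (π ω)) (fun ω => Y (π ω)) (fun ω => Z (π ω)) =
      condMutualInfo (law μ π) X Y Z := by
  simp only [condMutualInfo, condEntropy, ← entropy_comp]

theorem law_self (μ : Ω → ℝ) (a : Ω) : law μ (fun ω => ω) a = μ a := by
  rw [law, Finset.sum_filter, Finset.sum_eq_single a]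
  · exact if_pos rfl
  · exact fun b _ hb => if_neg hb
  · exact fun h => absurd (mem_univ a) h

/-- Relabelling by an injection preserves entropy, as values outside its range have mass zero. This
allows almost surely constant common parts to be dropped from the conditioning. -/
theorem entropy_eq_of_injective {μ : Ω → ℝ} {X : Ω → α} {Y : Ω → β} {g : α → β}
    (hg : Function.Injective g) (h : ∀ ω, μ ω ≠ 0 → Y ω = g (X ω)) :
    entropy μ Y = entropy μ X := by
  classical
  have h1 : ∀ b, law μ Y b = law (law μ X) g b := fun b =>
    (law_congr h b).trans (law_comp μ X g b)
  unfold entropy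
  congr 1
  refine (Finset.sum_of_injOn g hg.injOn (fun _ _ => mem_coe.2 (mem_univ _)) ?_ ?_).symm
  · intro b _ hb
    rw [h1, law, Finset.sum_eq_zero, Real.negMulLog_zero]
    intro a ha
    exact absurd ⟨a, mem_coe.2 (mem_univ a), (Finset.mem_filter.1 ha).2⟩ hb
  · intro a _
    rw [h1 (g a), law.eq_1 (law μ X), Finset.sum_eq_single a]
    · intro a' ha' hne
      exact absurd (hg (Finset.mem_filter.1 ha').2) hne
    · intro ha
      exact (ha (Finset.mem_filter.2 ⟨mem_univ a, rfl⟩)).elim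

theorem entropy_eq_zero_of_const {μ : Ω → ℝ} (hμ : ∑ ω, μ ω = 1) {X : Ω → α} {a : α}
    (h : ∀ ω, μ ω ≠ 0 → X ω = a) : entropy μ X = 0 := by
  rw [entropy_eq_of_injective (X := fun _ => ()) (g := fun _ => a)
    (Function.injective_of_subsingleton _) h]
  simp [entropy, law, hμ]

theorem condMutualInfo_eq_of_injective {μ : Ω → ℝ} (X : Ω → α) (Y : Ω → β) {Z : Ω → γ}
    {Z' : Ω → ζ} {g : ζ → γ} (hg : Function.Injective g) (h : ∀ ω, μ ω ≠ 0 → Z ω = g (Z' ω)) :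
    condMutualInfo μ X Y Z = condMutualInfo μ X Y Z' := by
  simp only [condMutualInfo, condEntropy]
  rw [entropy_eq_of_injective hg h,
    entropy_eq_of_injective (X := fun ω => (X ω, Z' ω)) (Y := fun ω => (X ω, Z ω))
      (g := Prod.map id g) (Function.injective_id.prodMap hg) fun ω hω => by rw [h ω hω]; rfl,
    entropy_eq_of_injective (X := fun ω => (Y ω, Z' ω)) (Y := fun ω => (Y ω, Z ω))
      (g := Prod.map id g) (Function.injective_id.prodMap hg) fun ω hω => by rw [h ω hω]; rfl,
    entropy_eq_of_injective (X := fun ω => (X ω, (Y ω, Z' ω))) (Y := fun ω => (X ω, (Y ω, Z ω)))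
      (g := Prod.map id (Prod.map id g))
      (Function.injective_id.prodMap (Function.injective_id.prodMap hg))
      fun ω hω => by rw [h ω hω]; rfl]

/-- The law of a coordinate is obtained by summing over the complementary coordinate. -/
theorem law_eq_sum (μ : Ω → ℝ) {F : Ω → α} (φ : α × β ≃ Ω) (hF : ∀ a b, F (φ (a, b)) = a)
    (a : α) : law μ F a = ∑ b, μ (φ (a, b)) := by
  classical
  rw [law, Finset.sum_filter, ← φ.sum_comp, Fintype.sum_prod_type, Finset.sum_eq_single a]
  · simp [hF]
  · intro a' _ hne
    simp [hF, hne]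
  · exact fun h => absurd (mem_univ _) h

theorem sum_negMulLog_mul_kernel (r : α → ℝ) (κ : α → β → ℝ) (hκ : ∀ a, ∑ b, κ a b = 1) :
    ∑ a, ∑ b, Real.negMulLog (r a * κ a b) =
      ∑ a, Real.negMulLog (r a) + ∑ a, r a * ∑ b, Real.negMulLog (κ a b) := by
  simp only [Real.negMulLog_mul, Finset.sum_add_distrib, ← Finset.sum_mul, ← Finset.mul_sum, hκ,
    one_mul]

/-- `I(X ; Y | Z)` for a Markov chain `Z → X → Y`. -/
theorem condMutualInfo_markov (r : ζ → ℝ) (κ : ζ → α → ℝ) (q : α → β → ℝ)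
    (hκ : ∀ z, ∑ x, κ z x = 1) (hq : ∀ x, ∑ y, q x y = 1) :
    condMutualInfo (fun ω : ζ × α × β => r ω.1 * κ ω.1 ω.2.1 * q ω.2.1 ω.2.2)
      (fun ω => ω.2.1) (fun ω => ω.2.2) (fun ω => ω.1) =
    (∑ z, r z * (∑ y, Real.negMulLog (∑ x, κ z x * q x y) -
      ∑ x, κ z x * ∑ y, Real.negMulLog (q x y))) / Real.log 2 := by
  set μ : ζ × α × β → ℝ := fun ω => r ω.1 * κ ω.1 ω.2.1 * q ω.2.1 ω.2.2 with hμ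
  have lXZ : ∀ w : α × ζ, law μ (fun ω => (ω.2.1, ω.1)) w = r w.2 * κ w.2 w.1 := by
    intro w
    rw [law_eq_sum μ (β := β) (F := fun ω => (ω.2.1, ω.1))
      ⟨fun v => (v.1.2, v.1.1, v.2), fun ω => ((ω.2.1, ω.1), ω.2.2), fun _ => rfl, fun _ => rfl⟩
      (fun _ _ => rfl)]
    simp [hμ, ← Finset.mul_sum, hq]
  have lZ : ∀ w : ζ, law μ (fun ω => ω.1) w = r w := by
    intro w
    rw [law_eq_sum μ (β := α × β) (F := fun ω => ω.1) (Equiv.refl _) (fun _ _ => rfl),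
      Fintype.sum_prod_type]
    simp [hμ, ← Finset.mul_sum, hq, hκ]
  have lYZ : ∀ w : β × ζ, law μ (fun ω => (ω.2.2, ω.1)) w
      = r w.2 * ∑ x, κ w.2 x * q x w.1 := by
    intro w
    rw [law_eq_sum μ (β := α) (F := fun ω => (ω.2.2, ω.1))
      ⟨fun v => (v.1.2, v.2, v.1.1), fun ω => ((ω.2.2, ω.1), ω.2.1), fun _ => rfl, fun _ => rfl⟩
      (fun _ _ => rfl)]
    simp [hμ, Finset.mul_sum, mul_assoc]
  have lXYZ : ∀ w : α × β × ζ, law μ (fun ω => (ω.2.1, (ω.2.2, ω.1))) w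
      = r w.2.2 * κ w.2.2 w.1 * q w.1 w.2.1 := by
    intro w
    rw [law_eq_sum μ (β := Unit) (F := fun ω => (ω.2.1, (ω.2.2, ω.1)))
      ⟨fun v => (v.1.2.2, v.1.1, v.1.2.1), fun ω => ((ω.2.1, (ω.2.2, ω.1)), ()), fun _ => rfl,
        fun _ => rfl⟩ (fun _ _ => rfl)]
    simp [hμ]
  simp only [condMutualInfo, condEntropy, entropy, lXZ, lZ, lYZ, lXYZ]
  rw [← sub_div, ← sub_div, ← sub_div]
  congr 1
  have hR : ∀ z, ∑ y, ∑ x, κ z x * q x y = 1 := fun z => by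
    rw [Finset.sum_comm]
    simp only [← Finset.mul_sum, hq, mul_one, hκ]
  have e1 : ∑ w : β × ζ, Real.negMulLog (r w.2 * ∑ x, κ w.2 x * q x w.1) =
      ∑ z, Real.negMulLog (r z) + ∑ z, r z * ∑ y, Real.negMulLog (∑ x, κ z x * q x y) := by
    rw [Fintype.sum_prod_type_right]
    exact sum_negMulLog_mul_kernel r (fun z y => ∑ x, κ z x * q x y) hR
  have e2 : ∑ w : α × β × ζ, Real.negMulLog (r w.2.2 * κ w.2.2 w.1 * q w.1 w.2.1) =
      ∑ w : α × ζ, Real.negMulLog (r w.2 * κ w.2 w.1) +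
        ∑ z, r z * ∑ x, κ z x * ∑ y, Real.negMulLog (q x y) := by
    have := sum_negMulLog_mul_kernel (fun w : α × ζ => r w.2 * κ w.2 w.1) (fun w y => q w.1 y)
      (fun w => hq w.1)
    rw [Fintype.sum_prod_type (γ := ℝ)] at this
    simp only [Finset.mul_sum]
    simp only [Fintype.sum_prod_type] at this ⊢
    rw [Finset.sum_congr rfl fun x _ => Finset.sum_comm, this]
    congr 1
    rw [Finset.sum_comm]
    simp only [Finset.mul_sum, mul_assoc]
  rw [e1, e2]
  simp only [mul_sub, Finset.sum_sub_distrib]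
  ring

end Laws

/-! ### The information gained through independent randomized maps of the additive source -/

section InfoGain

/-- The law of the additive source with parameter `p`, as a function of `p`. -/
def xorWeight (p : ℝ) (s : Fin 3 → ZMod 2) : ℝ :=
  if s 2 = s 0 + s 1 then bern p (s 0) * bern p (s 1) else 0

/-- The input law when user `i` sends `1` with probability `a i (s i)` on observing `s i`. -/
def inputLaw (p : ℝ) (a : Fin 3 → ZMod 2 → ℝ) (x : Fin 3 → ZMod 2) : ℝ :=
  ∑ s, xorWeight p s * ∏ i, bern (a i (s i)) (x i)

/-- `H(Y) - H(Y | X)` in nats for the input law `inputLaw p a`. -/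
noncomputable def infoGain (q : (Fin 3 → ZMod 2) → ZMod 2 × ZMod 2 → ℝ) (p : ℝ)
    (a : Fin 3 → ZMod 2 → ℝ) : ℝ :=
  ∑ y, Real.negMulLog (∑ x, inputLaw p a x * q x y) -
    ∑ x, inputLaw p a x * ∑ y, Real.negMulLog (q x y)

theorem continuous_bern (x : ZMod 2) : Continuous fun p => bern p x := by
  unfold bern
  split_ifs <;> fun_prop

theorem continuous_inputLaw (x : Fin 3 → ZMod 2) :
    Continuous fun v : ℝ × (Fin 3 → ZMod 2 → ℝ) => inputLaw v.1 v.2 x := by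
  unfold inputLaw
  refine continuous_finsetSum _ fun s _ => Continuous.mul ?_ ?_
  · unfold xorWeight
    split_ifs
    · exact ((continuous_bern _).comp continuous_fst).mul
        ((continuous_bern _).comp continuous_fst)
    · exact continuous_const
  · refine continuous_finsetProd _ fun i _ => (continuous_bern (x i)).comp ?_
    fun_prop

/-- Joint continuity in the source parameter and the randomized maps is what makes the compactness
argument near the critical rate possible. -/
theorem continuous_infoGain (q : (Fin 3 → ZMod 2) → ZMod 2 × ZMod 2 → ℝ) :
    Continuous fun v : ℝ × (Fin 3 → ZMod 2 → ℝ) => infoGain q v.1 v.2 := by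
  unfold infoGain
  refine Continuous.sub ?_ ?_
  · exact continuous_finsetSum _ fun y _ => Real.continuous_negMulLog.comp
      (continuous_finsetSum _ fun x _ => (continuous_inputLaw x).mul continuous_const)
  · exact continuous_finsetSum _ fun x _ => (continuous_inputLaw x).mul continuous_const

theorem sum_prod_bern_mul (b : Fin 3 → ℝ) (G : ZMod 2 → ℝ) :
    ∑ x : Fin 3 → ZMod 2, (∏ i, bern (b i) (x i)) * G (x 0) = ∑ x, bern (b 0) x * G x := by
  rw [sum_pi_three]
  refine Finset.sum_congr rfl fun x _ => ?_
  simp only [Fin.prod_univ_three]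
  calc _ = ∑ y, ∑ z, bern (b 0) x * G x * (bern (b 1) y * bern (b 2) z) :=
        Finset.sum_congr rfl fun y _ => Finset.sum_congr rfl fun z _ => by
          change bern (b 0) x * bern (b 1) y * bern (b 2) z * G x = _
          ring
    _ = _ := by simp only [← Finset.mul_sum, sum_bern, mul_one]

theorem sum_xorWeight_mul (p : ℝ) (F : ZMod 2 → ℝ) :
    ∑ s, xorWeight p s * F (s 0) = ∑ a, bern p a * F a := by
  have h : ∀ s : Fin 3 → ZMod 2, xorWeight p s * F (s 0) =
      if s 2 = s 0 + s 1 then bern p (s 0) * bern p (s 1) * F (s 0) else 0 := fun s => by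
    rw [xorWeight, ite_mul, zero_mul]
  rw [Finset.sum_congr rfl fun s _ => h s,
    sum_ite_add_eq fun s : Fin 3 → ZMod 2 => bern p (s 0) * bern p (s 1) * F (s 0)]
  refine Finset.sum_congr rfl fun a _ => ?_
  calc _ = ∑ b, bern p a * F a * bern p b := Finset.sum_congr rfl fun b _ => by
        change bern p a * bern p b * F a = _
        ring
    _ = _ := by rw [← Finset.mul_sum, sum_bern, mul_one]

/-- The marginal of the first input. -/
theorem sum_inputLaw_mul (p : ℝ) (a : Fin 3 → ZMod 2 → ℝ) (G : ZMod 2 → ℝ) :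
    ∑ x, inputLaw p a x * G (x 0) = ∑ s, bern p s * ∑ x, bern (a 0 s) x * G x := by
  rw [← sum_xorWeight_mul p fun s => ∑ x, bern (a 0 s) x * G x]
  simp only [inputLaw, Finset.sum_mul]
  rw [Finset.sum_comm]
  refine Finset.sum_congr rfl fun s _ => ?_
  simp only [mul_assoc, ← Finset.mul_sum]
  rw [sum_prod_bern_mul (fun i => a i (s i)) G]

theorem sum_inputLaw (p : ℝ) (a : Fin 3 → ZMod 2 → ℝ) : ∑ x, inputLaw p a x = 1 := by
  have := sum_inputLaw_mul p a fun _ => 1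
  simpa only [mul_one, sum_bern] using this

theorem xorWeight_nonneg {p : ℝ} (hp : p ∈ Set.Icc (0 : ℝ) 1) (s) : 0 ≤ xorWeight p s :=
  (xorSource p hp).mem_simplex.1 s

theorem inputLaw_nonneg {p : ℝ} (hp : p ∈ Set.Icc (0 : ℝ) 1) {a : Fin 3 → ZMod 2 → ℝ}
    (ha : ∀ i s, a i s ∈ Set.Icc (0 : ℝ) 1) (x) : 0 ≤ inputLaw p a x :=
  Finset.sum_nonneg fun s _ => mul_nonneg (xorWeight_nonneg hp s)
    (prod_nonneg fun i _ => bern_nonneg (ha i _) _)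

/-- Tangent-line bound for `negMulLog` at `1/4`. -/
theorem negMulLog_le_quarter {r : ℝ} (hr : 0 ≤ r) :
    Real.negMulLog r ≤ r * (2 * Real.log 2) + (1 / 4 - r) := by
  rcases hr.eq_or_lt with rfl | hr
  · simp
  · have h4 : Real.log (4 * r) = 2 * Real.log 2 + Real.log r := by
      rw [Real.log_mul (by norm_num) hr.ne', show (4 : ℝ) = 2 ^ 2 by norm_num, Real.log_pow]
      norm_num
    have h := Real.one_sub_inv_le_log_of_pos (show (0 : ℝ) < 4 * r by positivity)
    rw [h4] at h
    have h' := mul_le_mul_of_nonneg_left h hr.le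
    have e : r * (1 - (4 * r)⁻¹) = r - 1 / 4 := by field_simp
    rw [e] at h'
    rw [Real.negMulLog]
    linarith

theorem negMulLog_lt_quarter {r : ℝ} (hr : 0 ≤ r) (hne : r ≠ 1 / 4) :
    Real.negMulLog r < r * (2 * Real.log 2) + (1 / 4 - r) := by
  rcases hr.eq_or_lt with rfl | hr
  · simp
  · have h4 : Real.log ((4 * r)⁻¹) = -(2 * Real.log 2 + Real.log r) := by
      rw [Real.log_inv, Real.log_mul (by norm_num) hr.ne', show (4 : ℝ) = 2 ^ 2 by norm_num,
        Real.log_pow]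
      norm_num
    have h := Real.log_lt_sub_one_of_pos (show (0 : ℝ) < (4 * r)⁻¹ by positivity) (by
      intro h
      have := inv_eq_one.1 h
      exact hne (by linarith))
    rw [h4] at h
    have h' := mul_lt_mul_of_pos_left h hr
    have e : r * ((4 * r)⁻¹ - 1) = 1 / 4 - r := by field_simp
    rw [e] at h'
    rw [Real.negMulLog]
    linarith

/-- Sum the tangent-line bounds: the corrections 1/4 - R y cancel over the four outputs, and one
strict term suffices. This is the equality case of the maximum-entropy bound. -/
theorem sum_negMulLog_lt {R : ZMod 2 × ZMod 2 → ℝ} (h0 : ∀ y, 0 ≤ R y) (h1 : ∑ y, R y = 1)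
    {y₀ : ZMod 2 × ZMod 2} (hy₀ : R y₀ ≠ 1 / 4) :
    ∑ y, Real.negMulLog (R y) < 2 * Real.log 2 := by
  have h := Finset.sum_lt_sum (fun y (_ : y ∈ univ) => negMulLog_le_quarter (h0 y))
    ⟨y₀, mem_univ _, negMulLog_lt_quarter (h0 y₀) hy₀⟩
  rw [Finset.sum_add_distrib, ← Finset.sum_mul, Finset.sum_sub_distrib, h1] at h
  have hc : Fintype.card (ZMod 2 × ZMod 2) = 4 := rfl
  simp only [Finset.sum_const, Finset.card_univ, hc, nsmul_eq_mul] at h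
  norm_num at h
  linarith

theorem sum_negMulLog_le {R : ZMod 2 × ZMod 2 → ℝ} (h0 : ∀ y, 0 ≤ R y) (h1 : ∑ y, R y = 1) :
    ∑ y, Real.negMulLog (R y) ≤ 2 * Real.log 2 := by
  have h := Finset.sum_le_sum (fun y (_ : y ∈ univ) => negMulLog_le_quarter (h0 y))
  rw [Finset.sum_add_distrib, ← Finset.sum_mul, Finset.sum_sub_distrib, h1] at h
  have hc : Fintype.card (ZMod 2 × ZMod 2) = 4 := rfl
  simp only [Finset.sum_const, Finset.card_univ, hc, nsmul_eq_mul] at h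
  norm_num at h
  linarith

/-- If the inputs always satisfy `x₃ = x₁ + x₂`, the first input is a function of its source. -/
theorem eq_zero_or_one_of_inputLaw {p : ℝ} (h0 : 0 < p) (h1 : p < 1) {a : Fin 3 → ZMod 2 → ℝ}
    (ha : ∀ i s, a i s ∈ Set.Icc (0 : ℝ) 1)
    (hbad : ∀ x : Fin 3 → ZMod 2, x 2 ≠ x 0 + x 1 → inputLaw p a x = 0) (c : ZMod 2) :
    a 0 c = 0 ∨ a 0 c = 1 := by
  have hbp : ∀ b, 0 < bern p b := fun b => by
    unfold bern; split_ifs <;> linarith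
  -- The realization (c, 0, c) has positive probability, and given it the three inputs are
  -- independent; each forbidden input must then have product probability zero.
  have hz : ∀ x : Fin 3 → ZMod 2, x 2 ≠ x 0 + x 1 →
      bern (a 0 c) (x 0) * bern (a 1 0) (x 1) * bern (a 2 c) (x 2) = 0 := by
    intro x hx
    have h := (Finset.sum_eq_zero_iff_of_nonneg fun s _ => mul_nonneg
      (xorWeight_nonneg ⟨h0.le, h1.le⟩ s) (prod_nonneg fun i _ => bern_nonneg (ha i _) _)).1
      (hbad x hx) ![c, 0, c] (mem_univ _)
    have hw : xorWeight p ![c, 0, c] = bern p c * bern p 0 :=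
      if_pos (show c = c + 0 by rw [add_zero])
    rw [hw, mul_eq_zero, or_iff_right (mul_pos (hbp _) (hbp _)).ne', Fin.prod_univ_three] at h
    exact h
  have e1 := hz ![1, 0, 0] (by decide)
  have e2 := hz ![0, 1, 0] (by decide)
  have e3 := hz ![0, 0, 1] (by decide)
  have e4 := hz ![1, 1, 1] (by decide)
  simp [bern, -mul_eq_zero] at e1 e2 e3 e4
  -- With these weights every term acquires the factor α(1 - α), where α = `a 0 c`; the cofactors
  -- are the joint input probabilities of the other two users and sum to one.
  have : a 0 c * (1 - a 0 c) = 0 := by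
    linear_combination (1 - a 0 c) * e1 + a 0 c * e2 + a 0 c * e3 + (1 - a 0 c) * e4
  rcases mul_eq_zero.1 this with h | h
  · exact Or.inl h
  · exact Or.inr (by linarith)

theorem infoGain_lt {p δ : ℝ} (h0 : 0 < p) (h1 : p < 1) (h2 : p ≠ 1 / 2)
    (hδ : δ ∈ Set.Icc (0 : ℝ) 1) (hδ2 : δ ≠ 1 / 2) {a : Fin 3 → ZMod 2 → ℝ}
    (ha : ∀ i s, a i s ∈ Set.Icc (0 : ℝ) 1) :
    infoGain (xorMAC δ hδ).prob p a < 2 * (Real.log 2 - Real.binEntropy δ) := by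
  set q := (xorMAC δ hδ).prob with hq
  have hp : p ∈ Set.Icc (0 : ℝ) 1 := ⟨h0.le, h1.le⟩
  have hK := inputLaw_nonneg hp ha
  have hδlt : Real.binEntropy δ < Real.log 2 :=
    Real.binEntropy_lt_log_two.2 (by rwa [← one_div])
  have hR0 : ∀ y, 0 ≤ ∑ x, inputLaw p a x * q x y := fun y =>
    Finset.sum_nonneg fun x _ => mul_nonneg (hK x) (((xorMAC δ hδ).mem_simplex x).1 y)
  have hR1 : ∑ y, ∑ x, inputLaw p a x * q x y = 1 := by
    rw [Finset.sum_comm]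
    simp only [← Finset.mul_sum, hq, ((xorMAC δ hδ).mem_simplex _).2, mul_one, sum_inputLaw]
  have hle : ∀ x ∈ (univ : Finset (Fin 3 → ZMod 2)), inputLaw p a x * (2 * Real.binEntropy δ) ≤
      inputLaw p a x * ∑ y, Real.negMulLog (q x y) := fun x _ =>
    mul_le_mul_of_nonneg_left (le_sum_negMulLog_xorMAC δ hδ x) (hK x)
  have hsum : ∑ x, inputLaw p a x * (2 * Real.binEntropy δ) = 2 * Real.binEntropy δ := by
    rw [← Finset.sum_mul, sum_inputLaw, one_mul]
  -- The bound is the largest output entropy minus the least conditional entropy. Reaching it forces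
  -- both extremes: no mass on parity violations, and a uniform output.
  by_contra hge
  push Not at hge
  unfold infoGain at hge
  have hbad : ∀ x : Fin 3 → ZMod 2, x 2 ≠ x 0 + x 1 → inputLaw p a x = 0 := by
    intro x hx
    by_contra hne
    have hlt := Finset.sum_lt_sum hle ⟨x, mem_univ _, by
      rw [hq, sum_negMulLog_xorMAC_of_ne δ hδ hx]
      exact mul_lt_mul_of_pos_left (by linarith) (lt_of_le_of_ne (hK x) (Ne.symm hne))⟩
    have := sum_negMulLog_le hR0 hR1
    linarith
  have hunif : ∀ y, ∑ x, inputLaw p a x * q x y = 1 / 4 := by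
    intro y
    by_contra hne
    have := sum_negMulLog_lt hR0 hR1 hne
    have := Finset.sum_le_sum hle
    linarith
  -- The probability of Y₁ = 1, computed from the inputs and from the uniform output. As δ ≠ 1/2, it
  -- determines the law of X₁, which must be uniform.
  have hmarg : ∑ x, inputLaw p a x * bern δ (1 - x 0) = 1 / 2 := by
    have : ∑ x, inputLaw p a x * bern δ (1 - x 0) =
        ∑ y₂, ∑ x, inputLaw p a x * q x (1, y₂) := by
      rw [Finset.sum_comm]
      refine Finset.sum_congr rfl fun x _ => ?_
      rw [← Finset.mul_sum]
      by_cases hx : x 2 = x 0 + x 1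
      · have : ∀ y₂, q x (1, y₂) = bern δ (1 - x 0) * bern δ (y₂ - x 1) := fun y₂ => if_pos hx
        simp only [this, ← Finset.mul_sum, sum_bern_sub, mul_one]
      · rw [hbad x hx, zero_mul, zero_mul]
    rw [this, sum_zmod_two, hunif, hunif]
    norm_num
  rw [sum_inputLaw_mul p a fun x => bern δ (1 - x)] at hmarg
  simp [sum_zmod_two, bern] at hmarg
  set m := (1 - p) * a 0 0 + p * a 0 1 with hm
  have hm2 : (2 * m - 1) * (1 - 2 * δ) = 0 := by rw [hm]; linear_combination 2 * hmarg
  have hmh : m = 1 / 2 := by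
    rcases mul_eq_zero.1 hm2 with h | h
    · linarith
    · exact absurd (by linarith) hδ2
  -- A deterministic function of a Bernoulli(p) bit equals 1 with probability 0, p, 1 - p or 1; none
  -- of these is 1/2.
  rcases eq_zero_or_one_of_inputLaw h0 h1 ha hbad 0 with z0 | z0 <;>
  rcases eq_zero_or_one_of_inputLaw h0 h1 ha hbad 1 with z1 | z1 <;>
  rw [hm, z0, z1] at hmh
  · norm_num at hmh
  · exact h2 (by linarith)
  · exact h2 (by linarith)
  · norm_num at hmh

/-- The information gained stays below the source entropy in a neighbourhood of the critical
rate, uniformly in the randomized maps. -/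
theorem exists_infoGain_lt {δ : ℝ} (hδ : δ ∈ Set.Icc (0 : ℝ) 1) (hd0 : δ ≠ 0)
    (hd2 : δ ≠ 1 / 2) (hd1 : δ ≠ 1) :
    ∃ η : ℝ, 0 < η ∧ ∀ p ∈ Set.Icc (0 : ℝ) 1, ∀ a : Fin 3 → ZMod 2 → ℝ,
      (∀ i s, a i s ∈ Set.Icc (0 : ℝ) 1) →
      Real.log 2 - Real.binEntropy δ - η < Real.binEntropy p →
      Real.binEntropy p ≤ Real.log 2 - Real.binEntropy δ →
      infoGain (xorMAC δ hδ).prob p a < 2 * Real.binEntropy p := by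
  let B : Set (ℝ × (Fin 3 → ZMod 2 → ℝ)) :=
    Set.Icc 0 1 ×ˢ Set.pi Set.univ fun _ => Set.pi Set.univ fun _ => Set.Icc 0 1
  have hB : IsCompact B := isCompact_Icc.prod
    (isCompact_univ_pi fun _ => isCompact_univ_pi fun _ => isCompact_Icc)
  have hcH : Continuous fun v : ℝ × (Fin 3 → ZMod 2 → ℝ) => Real.binEntropy v.1 :=
    Real.binEntropy_continuous.comp continuous_fst
  -- The parameters at or below the critical rate that violate the desired inequality. By
  -- `infoGain_lt` none is critical, so the distance to the critical rate is positive on this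
  -- compact set, and η is a uniform lower bound for it.
  let C := B ∩ ({v | Real.binEntropy v.1 ≤ Real.log 2 - Real.binEntropy δ} ∩
    {v | 2 * Real.binEntropy v.1 ≤ infoGain (xorMAC δ hδ).prob v.1 v.2})
  have hC : IsCompact C := hB.inter_right
    ((isClosed_le hcH continuous_const).inter
      (isClosed_le (continuous_const.mul hcH) (continuous_infoGain _)))
  obtain ⟨η, hη, hCη⟩ := hC.exists_forall_le' (a := (0 : ℝ))
    (f := fun v => Real.log 2 - Real.binEntropy δ - Real.binEntropy v.1)
    (continuous_const.sub hcH).continuousOn (by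
      rintro ⟨p, a⟩ ⟨⟨hp, ha⟩, hle, hge⟩
      simp only [Set.mem_ofPred_eq] at hle hge
      rw [sub_pos]
      refine lt_of_le_of_ne hle fun heq => ?_
      obtain ⟨n0, n2, n1⟩ := ne_of_binEntropy_add_eq hδ hd0 hd2 hd1
        (show Real.binEntropy p + Real.binEntropy δ = Real.log 2 by linarith)
      have := infoGain_lt (lt_of_le_of_ne hp.1 n0.symm) (lt_of_le_of_ne hp.2 n1) n2 hδ hd2
        (a := a) fun i s => ha i (Set.mem_univ _) s (Set.mem_univ _)
      linarith)
  refine ⟨η, hη, fun p hp a ha h1 h2 => ?_⟩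
  by_contra hge
  push Not at hge
  have := hCη (p, a) ⟨⟨hp, fun i _ s _ => ha i s⟩, h2, hge⟩
  simp only at this
  linarith

end InfoGain

/-! ### Failure of the CES condition -/

section CESFailure

theorem xorSource_prob_ne_zero {p : ℝ} (hp : p ∈ Set.Icc (0 : ℝ) 1) (h0 : 0 < p) (h1 : p < 1)
    {s : Fin 3 → ZMod 2} (hs : s 2 = s 0 + s 1) : (xorSource p hp).prob s ≠ 0 := by
  have hbp : ∀ b, 0 < bern p b := fun b => by
    unfold bern; split_ifs <;> linarith
  have h : (xorSource p hp).prob s = bern p (s 0) * bern p (s 1) := if_pos hs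
  rw [h]
  exact (mul_pos (hbp _) (hbp _)).ne'

/-- A common function of two components of the additive source is almost surely constant. -/
theorem exists_const_of_isCommonFunction {p : ℝ} (hp : p ∈ Set.Icc (0 : ℝ) 1) (h0 : 0 < p)
    (h1 : p < 1) {A : Set (Fin 3)} {i j : Fin 3} (hi : i ∈ A) (hj : j ∈ A) (hij : i ≠ j) {k : ℕ}
    {W : (Fin 3 → ZMod 2) → Fin k} (hW : IsCommonFunction (xorSource p hp) A W) :
    ∃ w, ∀ s, (xorSource p hp).prob s ≠ 0 → W s = w := by
  obtain ⟨f, hf⟩ := hW i hi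
  obtain ⟨g, hg⟩ := hW j hj
  -- Any two coordinates of a triple satisfying the parity constraint can be prescribed freely, so
  -- the two representing functions agree at all pairs of arguments.
  have hex : ∀ i j : Fin 3, i ≠ j → ∀ a b : ZMod 2, ∃ s : Fin 3 → ZMod 2,
      s 2 = s 0 + s 1 ∧ s i = a ∧ s j = b := by decide
  have hfg : ∀ a b, f a = g b := by
    intro a b
    obtain ⟨s, hs, rfl, rfl⟩ := hex i j hij a b
    have hs' := xorSource_prob_ne_zero hp h0 h1 hs
    rw [← hf s hs', ← hg s hs']
  exact ⟨f 0, fun s hs => by rw [hf s hs, hfg (s i) 0, hfg 0 0]⟩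

/-- The CES condition yields randomized maps whose information gain is at least the entropy of
the source. -/
theorem exists_infoGain_ge_of_CESCondition {p δ : ℝ} (hp : p ∈ Set.Icc (0 : ℝ) 1)
    (hδ : δ ∈ Set.Icc (0 : ℝ) 1) (h0 : 0 < p) (h1 : p < 1)
    (h : CESCondition (xorSource p hp) (xorMAC δ hδ)) :
    ∃ a : Fin 3 → ZMod 2 → ℝ, (∀ i s, a i s ∈ Set.Icc (0 : ℝ) 1) ∧
      2 * Real.binEntropy p ≤ infoGain (xorMAC δ hδ).prob p a := by
  set P := xorSource p hp with hP
  set Q := xorMAC δ hδ with hQ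
  obtain ⟨c, hc⟩ := h
  have hlog : 0 < Real.log 2 := Real.log_pos (by norm_num)
  obtain ⟨w₀, hw₀⟩ := exists_const_of_isCommonFunction hp h0 h1 (Set.mem_univ 0) (Set.mem_univ 1)
    (by decide) c.isCommonPart₁₂₃.1
  have hWex : ∀ k, ∃ w, ∀ s, P.prob s ≠ 0 → c.W k s = w := fun k => by
    have : ∀ k : Fin 3, ∃ i j : Fin 3, i ≠ k ∧ j ≠ k ∧ i ≠ j := by decide
    obtain ⟨i, j, hik, hjk, hij⟩ := this k
    exact exists_const_of_isCommonFunction hp h0 h1 (A := {i | i ≠ k}) hik hjk hij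
      (c.isCommonPart k).1
  choose w hw using hWex
  -- Taking all three pairs puts every auxiliary variable in the conditioning, so only the private
  -- randomized maps of the users remain.
  have hB := hc.three_common univ
  have hleft : condEntropy P.prob (fun s => s)
      (fun s => (c.W₁₂₃ s, fun b : (univ : Finset (Fin 3)) => c.W b s)) =
        2 * Real.binEntropy p / Real.log 2 := by
    have hconst : ∀ s, P.prob s ≠ 0 →
        (c.W₁₂₃ s, fun b : (univ : Finset (Fin 3)) => c.W b s) =
          (w₀, fun b : (univ : Finset (Fin 3)) => w b) :=
      fun s hs => by
        rw [hw₀ s hs]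
        exact congrArg _ (funext fun b => hw b s hs)
    rw [condEntropy, entropy_eq_zero_of_const P.mem_simplex.2 hconst, sub_zero,
      entropy_eq_of_injective (X := fun s => s)
        (g := fun s => (s, (w₀, fun b : (univ : Finset (Fin 3)) => w b)))
        (fun a b h => (Prod.ext_iff.1 h).1) fun s hs => by rw [hconst s hs]]
    simp only [entropy, law_self]
    rw [hP, sum_negMulLog_xorSource]
  let ζ := Fin c.sizeU₁₂₃ × (∀ k, Fin (c.sizeU k))
  -- The law of the auxiliary variables, with each common part replaced by its almost sure value; it
  -- no longer depends on the source.
  let r : ζ → ℝ := fun z => c.pU₁₂₃ z.1 * ∏ k, c.pU k (w k) z.1 (z.2 k)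
  let a : ζ → Fin 3 → ZMod 2 → ℝ := fun z i s => c.pX i s z.1 (fun k => z.2 k) 1
  have hpX : ∀ (z : ζ) i s x, c.pX i s z.1 (fun k => z.2 k) x = bern (a z i s) x := by
    intro z i s x
    have hsum := (c.pX_mem i s z.1 (fun k => z.2 k)).2
    rw [sum_zmod_two] at hsum
    have hx : ∀ x : ZMod 2, x = 0 ∨ x = 1 := by decide
    rcases hx x with rfl | rfl
    · simp only [bern, a, if_neg (show (0 : ZMod 2) ≠ 1 by decide)]
      linarith
    · simp only [bern, a, if_true]
  have ha : ∀ z i s, a z i s ∈ Set.Icc (0 : ℝ) 1 := by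
    intro z i s
    have hmem := c.pX_mem i s z.1 (fun k => z.2 k)
    refine ⟨hmem.1 1, ?_⟩
    have hsum := hmem.2
    rw [sum_zmod_two] at hsum
    have := hmem.1 0
    simp only [a]
    linarith
  have hr0 : ∀ z, 0 ≤ r z := fun z =>
    mul_nonneg (c.pU₁₂₃_mem.1 _) (prod_nonneg fun k _ => (c.pU_mem k _ _).1 _)
  have hr1 : ∑ z, r z = 1 := by
    rw [Fintype.sum_prod_type]
    simp only [r, ← Finset.mul_sum]
    have : ∀ u₀, ∑ u : (∀ k, Fin (c.sizeU k)), ∏ k, c.pU k (w k) u₀ (u k) = 1 := fun u₀ => by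
      rw [← Fintype.piFinset_univ, ← Finset.prod_univ_sum]
      simp only [(c.pU_mem _ _ _).2, Finset.prod_const_one]
    simp only [this, mul_one, c.pU₁₂₃_mem.2]
  have hlaw : ∀ ω : ζ × (Fin 3 → ZMod 2) × (ZMod 2 × ZMod 2),
      law (c.joint Q) (fun ω => ((ω.2.1, ω.2.2.1), ω.2.2.2.1, ω.2.2.2.2)) ω =
        r ω.1 * inputLaw p (a ω.1) ω.2.1 * Q.prob ω.2.1 ω.2.2 := by
    intro ω
    rw [law_eq_sum (c.joint Q) (β := Fin 3 → ZMod 2)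
      (F := fun ω => ((ω.2.1, ω.2.2.1), ω.2.2.2.1, ω.2.2.2.2))
      ⟨fun v => (v.2, v.1.1.1, v.1.1.2, v.1.2.1, v.1.2.2),
        fun ω => (((ω.2.1, ω.2.2.1), ω.2.2.2.1, ω.2.2.2.2), ω.1), fun _ => rfl, fun _ => rfl⟩
      (fun _ _ => rfl)]
    simp only [inputLaw, Finset.mul_sum, Finset.sum_mul]
    refine Finset.sum_congr rfl fun s _ => ?_
    simp only [Equiv.coe_fn_mk, CESScheme.joint, r, ← hpX]
    have hPs : xorWeight p s = P.prob s := rfl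
    rw [hPs]
    -- Off the support the common parts may differ from their constants, but there the source weight
    -- vanishes.
    by_cases hs : P.prob s = 0
    · simp [hs]
    · simp only [hw _ s hs]
      ring
  have hright : condMutualInfo (c.joint Q) (fun (_, _, _, x, _) => x) (fun (_, _, _, _, y) => y)
        (fun (s, u₀, u, _, _) => (c.W₁₂₃ s, fun b : (univ : Finset (Fin 3)) => c.W b s, u₀,
          fun b : (univ : Finset (Fin 3)) => u b)) =
      (∑ z, r z * infoGain Q.prob p (a z)) / Real.log 2 := by
    rw [condMutualInfo_eq_of_injective (ζ := ζ) (Z' := fun ω => (ω.2.1, ω.2.2.1))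
      (g := fun z => (w₀, fun b : (univ : Finset (Fin 3)) => w b, z.1,
        fun b : (univ : Finset (Fin 3)) => z.2 b))]
    · have h1 := condMutualInfo_comp (c.joint Q)
        (fun ω => ((ω.2.1, ω.2.2.1), ω.2.2.2.1, ω.2.2.2.2))
        (fun ω : ζ × (Fin 3 → ZMod 2) × (ZMod 2 × ZMod 2) => ω.2.1) (fun ω => ω.2.2)
        (fun ω => ω.1)
      refine h1.trans ?_
      rw [show law (c.joint Q) (fun ω => ((ω.2.1, ω.2.2.1), ω.2.2.2.1, ω.2.2.2.2)) = _ from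
        funext hlaw]
      exact condMutualInfo_markov r (fun z => inputLaw p (a z)) Q.prob
        (fun z => sum_inputLaw p (a z)) fun x => (Q.mem_simplex x).2
    · rintro ⟨u₀, u⟩ ⟨u₀', u'⟩ hz
      simp only [Prod.mk.injEq, true_and] at hz
      refine Prod.ext hz.1 (funext fun k => ?_)
      exact congrFun hz.2 ⟨k, mem_univ k⟩
    · rintro ⟨s, u₀, u, x, y⟩ hω
      have hs : P.prob s ≠ 0 := fun hs => hω (by simp [CESScheme.joint, hs])
      simp only [hw₀ s hs, hw _ s hs]
  replace hB := (div_le_div_iff_of_pos_right hlog).1 (hleft.symm.trans_le (hB.trans_eq hright))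
  -- The right-hand side is now an average over realizations of the auxiliary variables, so it
  -- cannot reach 2h(p) if every realization falls short.
  by_contra! hall
  obtain ⟨z, -, hz⟩ : ∃ z ∈ (univ : Finset ζ), 0 < r z :=
    Finset.exists_lt_of_sum_lt (f := fun _ => (0 : ℝ)) (by rw [hr1]; simp)
  have hlt : ∑ z, r z * infoGain Q.prob p (a z) < ∑ z, r z * (2 * Real.binEntropy p) :=
    Finset.sum_lt_sum (fun z _ => mul_le_mul_of_nonneg_left (hall (a z) (ha z)).le (hr0 z))
      ⟨z, mem_univ _, mul_lt_mul_of_pos_left (hall (a z) (ha z)) hz⟩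
  rw [← Finset.sum_mul, hr1, one_mul] at hlt
  linarith

end CESFailure

end MACSources

theorem mainTheorem2 (δ : ℝ) (hδ : δ ∈ Set.Icc (0 : ℝ) 1) :
    (∀ (p : ℝ) (hp : p ∈ Set.Icc (0 : ℝ) 1),
      MACSources.Transmissible (MACSources.xorSource p hp) (MACSources.xorMAC δ hδ) ↔
        MACSources.hb p < 1 - MACSources.hb δ ∨
          (MACSources.hb p = 1 - MACSources.hb δ ∧ (δ = 0 ∨ δ = 1 / 2 ∨ δ = 1))) ∧
    (δ ≠ 0 → δ ≠ 1 / 2 → δ ≠ 1 →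
      (∀ (p : ℝ) (hp : p ∈ Set.Icc (0 : ℝ) 1), MACSources.hb p = 1 - MACSources.hb δ →
        ¬ MACSources.CESCondition (MACSources.xorSource p hp) (MACSources.xorMAC δ hδ)) ∧
      ∃ η : ℝ, 0 < η ∧ ∀ (p : ℝ) (hp : p ∈ Set.Icc (0 : ℝ) 1),
        1 - MACSources.hb δ - η < MACSources.hb p → MACSources.hb p < 1 - MACSources.hb δ →
        MACSources.Transmissible (MACSources.xorSource p hp) (MACSources.xorMAC δ hδ) ∧
        ¬ MACSources.CESCondition (MACSources.xorSource p hp) (MACSources.xorMAC δ hδ)) := by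
  refine ⟨fun p hp => MACSources.transmissible_xor_iff hp hδ, fun hd0 hd2 hd1 => ?_⟩
  obtain ⟨η, hη, hgain⟩ := MACSources.exists_infoGain_lt hδ hd0 hd2 hd1
  have hlog : 0 < Real.log 2 := Real.log_pos (by norm_num)
  have hδlt : Real.binEntropy δ < Real.log 2 :=
    Real.binEntropy_lt_log_two.2 (by rwa [← one_div])
  -- The minimum keeps h(p) positive, so that p ∉ {0, 1} and the common parts are constant; division
  -- by `Real.log 2` converts nats to bits.
  refine ⟨fun p hp heq hCES => ?_, min η (Real.log 2 - Real.binEntropy δ) / Real.log 2,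
    div_pos (lt_min hη (by linarith)) hlog, fun p hp hlow hup =>
      ⟨(MACSources.transmissible_xor_iff hp hδ).2 (Or.inl hup), fun hCES => ?_⟩⟩
  · rw [MACSources.hb_eq_one_sub_hb_iff] at heq
    obtain ⟨n0, -, n1⟩ := MACSources.ne_of_binEntropy_add_eq hδ hd0 hd2 hd1 heq
    obtain ⟨a, ha, hge⟩ := MACSources.exists_infoGain_ge_of_CESCondition hp hδ
      (lt_of_le_of_ne hp.1 n0.symm) (lt_of_le_of_ne hp.2 n1) hCES
    have := hgain p hp a ha (by linarith) (by linarith)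
    linarith
  · rw [MACSources.hb_lt_one_sub_hb_iff] at hup
    have hlow' : Real.log 2 - Real.binEntropy δ - min η (Real.log 2 - Real.binEntropy δ) <
        Real.binEntropy p := by
      have h := mul_lt_mul_of_pos_right hlow hlog
      simpa only [MACSources.hb, sub_mul, one_mul, div_mul_cancel₀ _ hlog.ne'] using h
    have hle₁ := min_le_left η (Real.log 2 - Real.binEntropy δ)
    have hle₂ := min_le_right η (Real.log 2 - Real.binEntropy δ)
    have hpos : 0 < Real.binEntropy p := by linarith
    have n0 : p ≠ 0 := by rintro rfl; simp at hpos
    have n1 : p ≠ 1 := by rintro rfl; simp at hpos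
    obtain ⟨a, ha, hge⟩ := MACSources.exists_infoGain_ge_of_CESCondition hp hδ
      (lt_of_le_of_ne hp.1 n0.symm) (lt_of_le_of_ne hp.2 n1) hCES
    have := hgain p hp a ha (by linarith) (by linarith)
    linarith
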